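/- **Setting.** In each round $t=1,\dots,T$ the environment reveals a closed convex set $\mathcal U_t\subseteq\mathbb R^d$ containing $0$, the learner plays $w_t\in\mathcal U_t$, the environment chooses a convex loss $f_t:\mathcal U_t\to\mathbb R$, and the learner observes a (sub)gradient $g_t$ of $f_t$ at $w_t$ and a number $b_t\ge\max_{w\in\mathcal U_t}|(w-w_t)^\top g_t|$. Put $B_0=0$, $B_t=\max_{s\le t}b_s$, and assume $B_T>0$. Let $\lceil z\rceil_+=\max\{\lceil z\rceil,1\}$, and read $0/0$ as $0$. For $u\in\bigcap_{t=1}^T\mathcal U_t$ let $$\tilde R_T^u=\sum_{t=1}^T(w_t-u)^\top g_t,\qquad V_T^u=\sum_{t=1}^T\big((u-w_t)^\top g_t\big)^2,\qquad F_T=\sum_{t=1}^T g_tg_t^\top .$$ **Algorithm (MetaGrad Full).** Let $\mathcal G=\{2^i:i\in\mathbb Z\}$. The set of active learning rates in round $t$ is $\mathcal A_t=\emptyset$ if $B_{t-1}=0$, and otherwise $$\mathcal A_t=\mathcal G\cap\Big(\frac1{2\big(\sum_{s=1}^{t-1}b_s\frac{B_{s-1}}{B_s}+B_{t-1}\big)},\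 \frac1{2B_{t-1}}\Big].$$ When $\eta\in\mathcal G$ first becomes active, an $\eta$-expert with parameter $\sigma=\sigma_\eta>0$ is started, with $\check w^\eta=0$, $\Lambda^\eta=\sigma^{-2}I$, $\Sigma^\eta=\sigma^2I$, and weight $p(\eta)=1$. In round $t$ every active expert predicts $w_t^\eta=\arg\min_{x\in\mathcal U_t}(x-\check w_t^\eta)^\top\Lambda_t^\eta(x-\check w_t^\eta)$, and the learner plays $$w_t=\frac{\sum_{\eta\in\mathcal A_t}p_t(\eta)\,\eta\,w_t^\eta}{\sum_{\eta\in\mathcal A_t}p_t(\eta)\,\eta}\qquad(w_t=0\text{ if }\mathcal A_t=\emptyset).$$ After observing $g_t$ and $b_t$, every active expert updates $$\Lambda_{t+1}^\eta=\Lambda_t^\eta+2\eta^2g_tg_t^\top,\quad \Sigma_{t+1}^\eta=\Sigma_t^\eta-\frac{2\eta^2\,\Sigma_t^\eta g_t\,g_t^\top\Sigma_t^\eta}{1+2\eta^2g_t^\top\Sigma_t^\eta g_t}=(\Lambda_{t+1}^\eta)^{-1},\quad \check w_{t+1}^\eta=w_t^\eta-\big(1+2\eta(w_t^\eta-w_t)^\top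 g_t\big)\eta\,\Sigma_{t+1}^\eta g_t .$$ Let $\tau+1$ be the first round of the current epoch (initially $\tau=0$). If $B_t>B_\tau\sum_{s=1}^tb_s/B_s$, then a reset takes place: $p_{t+1}(\eta)=1$ for all $\eta\in\mathcal A_t$, and a new epoch starts in round $t+1$. Otherwise, for all $\eta\in\mathcal A_t$, $$p_{t+1}(\eta)=\frac{p_t(\eta)e^{-\bar\ell_t^\eta(w_t^\eta)}}{\sum_{\theta\in\mathcal A_t}p_t(\theta)e^{-\bar\ell_t^\theta(w_t^\theta)}}\sum_{\theta\in\mathcal A_t}p_t(\theta),\qquad \bar\ell_t^\eta(x)=\eta(x-w_t)^\top\bar g_t+\big(\eta(x-w_t)^\top\bar g_t\big)^2,\quad \bar g_t=\tfrac{B_{t-1}}{B_t}g_t .$$ **Theorem 11 (The Road Not Taken).** Suppose that each $\eta$-expert in MetaGrad Full is tuned with $\sigma_\eta=1/\sqrt{\alpha\eta}$ for a given $\alpha>0$. Then for all $u\in\bigcap_{t=1}^T\mathcal U_t$ the linearized regret is simultaneously bounded by $$\tilde R_T^u\le\tfrac52\sqrt{V_T^uZ_T}+5B_TZ_T+\tfrac\alpha2\|u\|_2^2+2B_T,$$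 where $$Z_T=\operatorname{rk}(F_T)\ln\Big(1+\frac{\sum_{t=1}^T\|g_t\|_2^2}{B_T\,\alpha\,\operatorname{rk}(F_T)}\Big)+2\ln\lceil2\log_2T\rceil_++\tfrac12$$ (the first term being $0$ if $F_T=0$), and by $$\tilde R_T^u\le\tfrac52\sqrt{V_T^uZ_T'}+5B_TZ_T'+\tfrac2\alpha\sum_{t=1}^T\|g_t\|_2^2+\tfrac\alpha2\|u\|_2^2+2B_T,$$ where $Z_T'=2\ln\lceil2\log_2T\rceil_++\tfrac12$. -/

import Mathlib

noncomputable section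

open scoped Matrix

namespace MetaGrad

/-- Running maximum `B_t = max_{s ≤ t} b_s` of the range bounds, with `B_0 = 0`. -/
def runMax (b : ℕ → ℝ) : ℕ → ℝ
  | 0 => 0
  | t + 1 => max (runMax b t) (b (t + 1))

/-- `⌈z⌉₊ = max {⌈z⌉, 1}`: the smallest integer that is at least `z` and at least `1`. -/
def ceilPos (z : ℝ) : ℤ := max ⌈z⌉ 1

/-- The infinite grid `{2 ^ i : i ∈ ℤ}` of learning rates. -/
def grid : Set ℝ := Set.range fun i : ℤ => (2 : ℝ) ^ i

open Classical in
/-- The set of learning rates that are active in round `t ≥ 1`. -/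
def active (b : ℕ → ℝ) (t : ℕ) : Set ℝ :=
  if runMax b (t - 1) = 0 then ∅
  else grid ∩ Set.Ioc
    (1 / (2 * (∑ s ∈ Finset.Ico 1 t, b s * (runMax b (s - 1) / runMax b s) + runMax b (t - 1))))
    (1 / (2 * runMax b (t - 1)))

/-- After round `t` of an epoch that started at time `τ + 1`, a reset is needed. -/
def ResetNeeded (b : ℕ → ℝ) (τ t : ℕ) : Prop :=
  runMax b t > runMax b τ * ∑ s ∈ Finset.Icc 1 t, b s / runMax b s

variable {d : ℕ}

/-- The surrogate loss of `u` with learning rate `η`, controller prediction `w` and gradient `g`. -/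
def surrogate (η : ℝ) (w g u : Fin d → ℝ) : ℝ :=
  η * ((u - w) ⬝ᵥ g) + (η * ((u - w) ⬝ᵥ g)) ^ 2

/-- A minimizer of `(y - x)ᵀ L (y - x)` over `y ∈ K`. It exists and is unique if `L` is positive
definite and `K` is closed, convex and nonempty. -/
def project (L : Matrix (Fin d) (Fin d) ℝ) (K : Set (Fin d → ℝ)) (x : Fin d → ℝ) : Fin d → ℝ :=
  Classical.epsilon fun y =>
    y ∈ K ∧ IsMinOn (fun z : Fin d → ℝ => (z - x) ⬝ᵥ (L *ᵥ (z - x))) K y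

/-- The variables maintained by one `η`-expert: the unprojected point, the inverse covariance
matrix and the covariance matrix. -/
structure Expert (d : ℕ) where
  wcheck : Fin d → ℝ
  Lam : Matrix (Fin d) (Fin d) ℝ
  Sig : Matrix (Fin d) (Fin d) ℝ

/-- Initialization of an expert with parameter `σ`. -/
def Expert.init (σ : ℝ) : Expert d where
  wcheck := 0
  Lam := (1 / σ ^ 2) • (1 : Matrix (Fin d) (Fin d) ℝ)
  Sig := σ ^ 2 • (1 : Matrix (Fin d) (Fin d) ℝ)

/-- Prediction of an expert on the domain `K`. -/
def Expert.predict (e : Expert d) (K : Set (Fin d → ℝ)) : Fin d → ℝ :=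
  project e.Lam K e.wcheck

/-- Update of an `η`-expert on the domain `K`, given the prediction `w` of the controller and the
gradient `g` observed there. -/
def Expert.update (η : ℝ) (e : Expert d) (K : Set (Fin d → ℝ)) (w g : Fin d → ℝ) : Expert d :=
  let Sig' := e.Sig - (2 * η ^ 2 / (1 + 2 * η ^ 2 * (g ⬝ᵥ (e.Sig *ᵥ g)))) •
    Matrix.vecMulVec (e.Sig *ᵥ g) (g ᵥ* e.Sig)
  { wcheck := e.predict K -
      ((1 + 2 * η * ((e.predict K - w) ⬝ᵥ g)) * η) • (Sig' *ᵥ g)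
    Lam := e.Lam + (2 * η ^ 2) • Matrix.vecMulVec g g
    Sig := Sig' }

/-- The state of the controller and of all experts between two rounds. Only the entries at active
learning rates are ever read or changed, so that an expert which was not started yet still
has its initial values, and the weight `1`; the current epoch started at time `τ + 1`. -/
structure State (d : ℕ) where
  expert : ℝ → Expert d
  p : ℝ → ℝ
  τ : ℕ

/-- The initial state. The expert with learning rate `η` is tuned with the parameter `σ η`. -/
def State.init (σ : ℝ → ℝ) : State d where
  expert := fun η => Expert.init (σ η)
  p := fun _ => 1
  τ := 0

open Classical in
/-- The prediction of the controller, with set `A` of active learning rates and domain `K`. -/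
def State.predict (S : State d) (A : Set ℝ) (K : Set (Fin d → ℝ)) : Fin d → ℝ :=
  if A = ∅ then 0
  else (∑ᶠ η ∈ A, S.p η * η)⁻¹ • ∑ᶠ η ∈ A, (S.p η * η) • (S.expert η).predict K

open Classical in
/-- The state after round `t ≥ 1`, obtained from the state `S` before it. The domain in this round
is `K`, the gradient is `g`, and the range bounds are given by `b`. -/
def State.step (b : ℕ → ℝ) (t : ℕ) (K : Set (Fin d → ℝ)) (g : Fin d → ℝ) (S : State d) :
    State d :=
  let A := active b t
  let w := S.predict A K
  -- clipped gradient
  let gc := (runMax b (t - 1) / runMax b t) • g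
  -- weight after an exponential weights update with the clipped surrogate loss
  let q : ℝ → ℝ := fun η =>
    S.p η * Real.exp (-surrogate η w gc ((S.expert η).predict K))
  { expert := fun η => if η ∈ A then (S.expert η).update η K w g else S.expert η
    p := fun η =>
      if η ∈ A then
        if ResetNeeded b S.τ t then 1
        else q η / (∑ᶠ θ ∈ A, q θ) * ∑ᶠ θ ∈ A, S.p θ
      else S.p η
    τ := if ResetNeeded b S.τ t then t else S.τ }

/-- The state of MetaGrad Full after the first `t` rounds, when its `η`-expert is tuned with the
parameter `σ η`, and the domains, gradients and range bounds are `U s`, `g s`, `b s` in round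
`s = 1, 2, …`. -/
def state (σ : ℝ → ℝ) (U : ℕ → Set (Fin d → ℝ)) (g : ℕ → Fin d → ℝ) (b : ℕ → ℝ) : ℕ → State d
  | 0 => State.init σ
  | t + 1 => (state σ U g b t).step b (t + 1) (U (t + 1)) (g (t + 1))

/-- The prediction `w_t` of MetaGrad Full in round `t ≥ 1`. It depends on the domains up to round
`t` and on the gradients and range bounds of the rounds before `t` only. -/
def iterate (σ : ℝ → ℝ) (U : ℕ → Set (Fin d → ℝ)) (g : ℕ → Fin d → ℝ) (b : ℕ → ℝ) (t : ℕ) :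
    Fin d → ℝ :=
  (state σ U g b (t - 1)).predict (active b t) (U t)

/-- The protocol over rounds `1, …, T` for a learner that plays `w t` in round `t`: closed convex
domains that contain the origin, convex losses `f t` on them, (sub)gradients `g t` of `f t`
at `w t`, and upper bounds `b t` on `max_{x ∈ U t} |(x - w t)ᵀ (g t)|`. -/
structure IsPlay (T : ℕ) (U : ℕ → Set (Fin d → ℝ)) (f : ℕ → (Fin d → ℝ) → ℝ)
    (w g : ℕ → Fin d → ℝ) (b : ℕ → ℝ) : Prop where
  isClosed : ∀ t ∈ Finset.Icc 1 T, IsClosed (U t)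
  convex : ∀ t ∈ Finset.Icc 1 T, Convex ℝ (U t)
  zero_mem : ∀ t ∈ Finset.Icc 1 T, (0 : Fin d → ℝ) ∈ U t
  convexOn : ∀ t ∈ Finset.Icc 1 T, ConvexOn ℝ (U t) (f t)
  subgradient : ∀ t ∈ Finset.Icc 1 T, ∀ x ∈ U t, f t (w t) + (x - w t) ⬝ᵥ g t ≤ f t x
  range_bound : ∀ t ∈ Finset.Icc 1 T, ∀ x ∈ U t, |(x - w t) ⬝ᵥ g t| ≤ b t

/-- The linearized regret with respect to `u` over `T` rounds. -/
def linRegret (w g : ℕ → Fin d → ℝ) (T : ℕ) (u : Fin d → ℝ) : ℝ :=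
  ∑ t ∈ Finset.Icc 1 T, (w t - u) ⬝ᵥ g t

/-- The variance `V_T` with respect to `u`. -/
def variance (w g : ℕ → Fin d → ℝ) (T : ℕ) (u : Fin d → ℝ) : ℝ :=
  ∑ t ∈ Finset.Icc 1 T, ((u - w t) ⬝ᵥ g t) ^ 2

/-- The gradient covariance matrix `F_T`. -/
def covariance (g : ℕ → Fin d → ℝ) (T : ℕ) : Matrix (Fin d) (Fin d) ℝ :=
  ∑ t ∈ Finset.Icc 1 T, Matrix.vecMulVec (g t) (g t)

/-- The squared Euclidean norm. -/
def sqNorm (u : Fin d → ℝ) : ℝ := ‖WithLp.toLp 2 u‖ ^ 2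

/-- `Z'_T`. -/
def lowZ (T : ℕ) : ℝ := 2 * Real.log (ceilPos (2 * Real.logb 2 T)) + 1 / 2

/-- `Z_T`. If `F_T` has rank `0`, the first term is `0`. -/
def fullZ (α : ℝ) (g : ℕ → Fin d → ℝ) (b : ℕ → ℝ) (T : ℕ) : ℝ :=
  (covariance g T).rank *
      Real.log (1 + (∑ t ∈ Finset.Icc 1 T, sqNorm (g t)) /
        (runMax b T * α * (covariance g T).rank))
    + 2 * Real.log (ceilPos (2 * Real.logb 2 T)) + 1 / 2

end MetaGrad

end

/-! Fix a grid rate η ≤ 1/(2B_T) and write N = ⌈2 log₂ T⌉₊. The surrogate loss vanishes at w_t, and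
its linear part at u is -η times the instantaneous regret. So η·(regret) is η²V plus the sum of
minus the surrogate loss of u, and inserting the prediction of the η-expert separates two regrets
(`mul_regret_le`).

Expert against u: the surrogate is a quadratic of rank one and the expert is an online Newton step
on it. The potential ½‖u - w̌‖² in the metric Λ telescopes (`surrogate_sub_add_quadratic_le`) and
leaves ½σ⁻²‖u‖² + E, where E sums 2η²gᵀΣg over the active rounds. E is bounded either by a
log-determinant, hence by the rank of F_T (`sum_le_rank_mul_log`), or through Σ ≤ σ²I
(`sum_le_sum_sqNorm`). This gives the two bounds of the theorem.

Controller against expert: weights tilted by η and e^{-y-y²} ≤ 1 - y keep the exponential-weights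
potential from growing. At most N rates matter within one epoch, so an epoch costs at most ln N.
Only the last two epochs are charged this way; the reset rule makes all earlier ones cost at most
ηB_T together (`sum_clippedGain_epochs`).

Remaining costs: clipping costs ηB_T (`neg_surrogate_le_clipped`), and rounds in which η is inactive
cost 1/2 (`sum_inactive_le`). Division by η gives `regret_le_of_grid`, and a grid point near the
minimizer of ηV + Z/η finishes the proof (`exists_grid_le`). -/

noncomputable section

open scoped Matrix

namespace MetaGrad

/-! ### Projections in a quadratic norm, rank-one updates and log-determinants. -/

section LinearAlgebra

variable {d : ℕ}

theorem dotProduct_mulVec_symm {L : Matrix (Fin d) (Fin d) ℝ} (hL : Lᵀ = L) (x y : Fin d → ℝ) :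
    x ⬝ᵥ (L *ᵥ y) = y ⬝ᵥ (L *ᵥ x) := by
  rw [Matrix.dotProduct_mulVec, ← Matrix.mulVec_transpose, hL, dotProduct_comm]

theorem quadratic_add {L : Matrix (Fin d) (Fin d) ℝ} (hL : Lᵀ = L) (x y : Fin d → ℝ) (s : ℝ) :
    (x + s • y) ⬝ᵥ (L *ᵥ (x + s • y)) =
      x ⬝ᵥ (L *ᵥ x) + 2 * s * (y ⬝ᵥ (L *ᵥ x)) + s ^ 2 * (y ⬝ᵥ (L *ᵥ y)) := by
  simp only [Matrix.mulVec_add, Matrix.mulVec_smul, add_dotProduct, dotProduct_add,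
    smul_dotProduct, dotProduct_smul, smul_eq_mul]
  rw [dotProduct_mulVec_symm hL x y]
  ring

theorem sqNorm_eq_dotProduct (x : Fin d → ℝ) : sqNorm x = x ⬝ᵥ x := by
  rw [sqNorm, EuclideanSpace.norm_sq_eq]
  simp [dotProduct, sq]

theorem sq_le_dotProduct_self (x : Fin d → ℝ) (i : Fin d) : x i ^ 2 ≤ x ⬝ᵥ x := by
  rw [sq]
  exact Finset.single_le_sum (f := fun i => x i * x i) (fun j _ => mul_self_nonneg (x j))
    (Finset.mem_univ i)

/-- Coercivity, supplied by c > 0, makes the sublevel set through any point of K compact. -/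
theorem exists_isMinOn_quadratic {L : Matrix (Fin d) (Fin d) ℝ} {c : ℝ} (hc : 0 < c)
    (hL : ∀ z, c * (z ⬝ᵥ z) ≤ z ⬝ᵥ (L *ᵥ z)) {K : Set (Fin d → ℝ)} (hK : IsClosed K)
    (hne : K.Nonempty) (x : Fin d → ℝ) :
    ∃ y, y ∈ K ∧ IsMinOn (fun z : Fin d → ℝ => (z - x) ⬝ᵥ (L *ᵥ (z - x))) K y := by
  obtain ⟨k, hk⟩ := hne
  set q : (Fin d → ℝ) → ℝ := fun z => (z - x) ⬝ᵥ (L *ᵥ (z - x)) with hq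
  have hcont : Continuous q := by
    have h : Continuous fun z : Fin d → ℝ => z - x := by fun_prop
    exact h.dotProduct (Continuous.matrix_mulVec continuous_const h)
  have hcomp : IsCompact (K ∩ {z | q z ≤ q k}) := by
    refine Metric.isCompact_of_isClosed_isBounded
      (hK.inter (isClosed_le hcont continuous_const)) ?_
    refine isBounded_iff_forall_norm_le.2 ⟨Real.sqrt (q k / c) + ‖x‖, fun z hz => ?_⟩
    have h1 : (z - x) ⬝ᵥ (z - x) ≤ q k / c := by
      rw [le_div_iff₀ hc, mul_comm]
      exact (hL _).trans hz.2
    have h2 : ‖z - x‖ ≤ Real.sqrt (q k / c) := by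
      refine (pi_norm_le_iff_of_nonneg (Real.sqrt_nonneg _)).2 fun i => ?_
      exact Real.abs_le_sqrt ((sq_le_dotProduct_self (z - x) i).trans h1)
    calc ‖z‖ = ‖(z - x) + x‖ := by simp
      _ ≤ _ := (norm_add_le _ _).trans (by gcongr)
  obtain ⟨y, hy, hmin⟩ := hcomp.exists_isMinOn ⟨k, hk, le_refl (q k)⟩ hcont.continuousOn
  refine ⟨y, hy.1, fun z hz => ?_⟩
  by_cases h : q z ≤ q k
  · exact hmin ⟨hz, h⟩
  · exact hy.2.trans (not_le.1 h).le

theorem project_spec {L : Matrix (Fin d) (Fin d) ℝ} {c : ℝ} (hc : 0 < c)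
    (hL : ∀ z, c * (z ⬝ᵥ z) ≤ z ⬝ᵥ (L *ᵥ z)) {K : Set (Fin d → ℝ)} (hK : IsClosed K)
    (hne : K.Nonempty) (x : Fin d → ℝ) :
    project L K x ∈ K ∧
      IsMinOn (fun z : Fin d → ℝ => (z - x) ⬝ᵥ (L *ᵥ (z - x))) K (project L K x) :=
  Classical.epsilon_spec (exists_isMinOn_quadratic hc hL hK hne x)

/-- The projection onto a convex set does not increase the distance to the points of the set. -/
theorem quadratic_sub_le_of_isMinOn {L : Matrix (Fin d) (Fin d) ℝ} (hsym : Lᵀ = L)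
    (hnn : ∀ z, 0 ≤ z ⬝ᵥ (L *ᵥ z)) {K : Set (Fin d → ℝ)} (hK : Convex ℝ K) {x y u : Fin d → ℝ}
    (hy : y ∈ K) (hmin : IsMinOn (fun z : Fin d → ℝ => (z - x) ⬝ᵥ (L *ᵥ (z - x))) K y)
    (hu : u ∈ K) :
    (u - y) ⬝ᵥ (L *ᵥ (u - y)) ≤ (u - x) ⬝ᵥ (L *ᵥ (u - x)) := by
  set D := (u - y) ⬝ᵥ (L *ᵥ (u - y)) with hD
  set C := (u - y) ⬝ᵥ (L *ᵥ (y - x)) with hC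
  have key : ∀ s : ℝ, 0 < s → s ≤ 1 → 0 ≤ 2 * C + s * D := by
    intro s hs hs1
    have hmem : y + s • (u - y) ∈ K := hK.add_smul_sub_mem hy hu ⟨hs.le, hs1⟩
    have h := hmin hmem
    have e : y + s • (u - y) - x = (y - x) + s • (u - y) := by abel
    simp only [Set.mem_ofPred_eq] at h
    rw [e, quadratic_add hsym, ← hC, ← hD] at h
    have : 0 ≤ s * (2 * C + s * D) := by nlinarith
    exact nonneg_of_mul_nonneg_right this hs
  have hC0 : 0 ≤ C := by
    by_contra hneg
    push Not at hneg
    have hD0 : 0 ≤ D := hnn _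
    -- This step size makes s·D ≤ -C, so 2C + sD ≤ C < 0; the denominator D + 1 covers D = 0.
    have h1 := key (min 1 (-C / (D + 1))) (lt_min one_pos (div_pos (by linarith) (by linarith)))
      (min_le_left _ _)
    have h2 : min 1 (-C / (D + 1)) * D ≤ -C := by
      calc min 1 (-C / (D + 1)) * D ≤ (-C / (D + 1)) * (D + 1) :=
            mul_le_mul (min_le_right _ _) (by linarith) hD0
              (div_nonneg (by linarith) (by linarith))
        _ = -C := by field_simp
    linarith
  have e : u - x = (y - x) + (1 : ℝ) • (u - y) := by simp
  rw [e, quadratic_add hsym, ← hC, ← hD]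
  have := hnn (y - x)
  linarith

theorem dotProduct_vecMulVec_mulVec (x v y : Fin d → ℝ) :
    x ⬝ᵥ (Matrix.vecMulVec v v *ᵥ y) = (x ⬝ᵥ v) * (v ⬝ᵥ y) := by
  simp [Matrix.vecMulVec_mulVec, mul_comm]

theorem transpose_vecMulVec_self (v : Fin d → ℝ) :
    (Matrix.vecMulVec v v)ᵀ = Matrix.vecMulVec v v := by
  rw [Matrix.transpose_vecMulVec]

theorem det_add_smul_vecMulVec {L S : Matrix (Fin d) (Fin d) ℝ} (h : L * S = 1) (a : ℝ)
    (v : Fin d → ℝ) :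
    (L + a • Matrix.vecMulVec v v).det = L.det * (1 + a * (v ⬝ᵥ (S *ᵥ v))) := by
  have e : L + a • Matrix.vecMulVec v v
      = L * (1 + Matrix.replicateCol Unit (a • (S *ᵥ v)) * Matrix.replicateRow Unit v) := by
    rw [mul_add, mul_one, ← Matrix.vecMulVec_eq, Matrix.mul_vecMulVec, Matrix.mulVec_smul,
      Matrix.mulVec_mulVec, h, Matrix.one_mulVec, Matrix.smul_vecMulVec]
  rw [e, Matrix.det_mul, Matrix.det_one_add_replicateCol_mul_replicateRow, dotProduct_smul,
    smul_eq_mul]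

theorem sherman_morrison {L S : Matrix (Fin d) (Fin d) ℝ} (h : L * S = 1) {a : ℝ}
    {v : Fin d → ℝ} (hv : 1 + a * (v ⬝ᵥ (S *ᵥ v)) ≠ 0) :
    (L + a • Matrix.vecMulVec v v) * (S - (a / (1 + a * (v ⬝ᵥ (S *ᵥ v)))) •
      Matrix.vecMulVec (S *ᵥ v) (v ᵥ* S)) = 1 := by
  set y := v ⬝ᵥ (S *ᵥ v) with hy
  have h1 : L * Matrix.vecMulVec (S *ᵥ v) (v ᵥ* S) = Matrix.vecMulVec v (v ᵥ* S) := by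
    rw [Matrix.mul_vecMulVec, Matrix.mulVec_mulVec, h, Matrix.one_mulVec]
  have h2 : Matrix.vecMulVec v v * Matrix.vecMulVec (S *ᵥ v) (v ᵥ* S)
      = y • Matrix.vecMulVec v (v ᵥ* S) := by
    rw [Matrix.vecMulVec_mul_vecMulVec, ← hy, Matrix.vecMulVec_smul]
  rw [add_mul, mul_sub, mul_sub, h, smul_mul_assoc, Matrix.mul_smul, h1, smul_mul_assoc,
    Matrix.mul_smul, h2, Matrix.vecMulVec_mul]
  have hk : -(a / (1 + a * y)) + a - a * (a / (1 + a * y)) * y = 0 := by field_simp; ring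
  have : (1 : Matrix (Fin d) (Fin d) ℝ) - (a / (1 + a * y)) • Matrix.vecMulVec v (v ᵥ* S)
      + (a • Matrix.vecMulVec v (v ᵥ* S)
        - a • (a / (1 + a * y)) • y • Matrix.vecMulVec v (v ᵥ* S))
      = 1 + (-(a / (1 + a * y)) + a - a * (a / (1 + a * y)) * y) •
        Matrix.vecMulVec v (v ᵥ* S) := by
    module
  rw [this, hk, zero_smul, add_zero]

theorem posSemidef_vecMulVec_self (v : Fin d → ℝ) : (Matrix.vecMulVec v v).PosSemidef := by
  simpa using Matrix.posSemidef_vecMulVec_self_star v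

/-- An expert sees only the rounds in which it is active; this adds the missing rounds, so that the
bound can be stated with the full F_T. -/
theorem det_le_det_add_sum {ι : Type*} (s : Finset ι) {a : ℝ} (ha : 0 ≤ a)
    (v : ι → Fin d → ℝ) {L : Matrix (Fin d) (Fin d) ℝ} (hL : L.PosDef) :
    L.det ≤ (L + a • ∑ i ∈ s, Matrix.vecMulVec (v i) (v i)).det := by
  classical
  induction s using Finset.induction_on with
  | empty => simp
  | insert i s hi ih =>
    have hpd : (L + a • ∑ j ∈ s, Matrix.vecMulVec (v j) (v j)).PosDef :=
      hL.add_posSemidef ((Matrix.posSemidef_sum s fun j _ =>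
        posSemidef_vecMulVec_self (v j)).smul ha)
    refine ih.trans ?_
    rw [Finset.sum_insert hi, add_comm (Matrix.vecMulVec _ _), smul_add, ← add_assoc]
    set M := L + a • ∑ j ∈ s, Matrix.vecMulVec (v j) (v j)
    have hinv : M * M⁻¹ = 1 := Matrix.mul_nonsing_inv _ hpd.det_pos.ne'.isUnit
    rw [det_add_smul_vecMulVec hinv]
    have h0 : 0 ≤ v i ⬝ᵥ (M⁻¹ *ᵥ v i) := by
      simpa using hpd.inv.posSemidef.dotProduct_mulVec_nonneg (v i)
    nlinarith [hpd.det_pos, mul_nonneg ha h0, mul_nonneg hpd.det_pos.le (mul_nonneg ha h0)]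

theorem det_smul_one_add_eq_prod {F : Matrix (Fin d) (Fin d) ℝ} (hF : F.IsHermitian) (c : ℝ) :
    (c • (1 : Matrix (Fin d) (Fin d) ℝ) + F).det = ∏ i, (c + hF.eigenvalues i) := by
  have h := congrArg (Polynomial.eval (-c)) hF.charpoly_eq
  rw [Matrix.eval_charpoly, Polynomial.eval_prod] at h
  simp only [Polynomial.eval_sub, Polynomial.eval_X, Polynomial.eval_C] at h
  have e : c • (1 : Matrix (Fin d) (Fin d) ℝ) + F = -(Matrix.scalar (Fin d) (-c) - F) := by
    rw [Matrix.smul_one_eq_diagonal]; simp [Matrix.scalar_apply]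
    ext i j; by_cases hij : i = j <;> simp [hij, add_comm]
  rw [e, Matrix.det_neg, h, Fintype.card_fin]
  rw [show (-1 : ℝ) ^ d = ∏ _i : Fin d, (-1 : ℝ) by simp, ← Finset.prod_mul_distrib]
  exact Finset.prod_congr rfl fun i _ => by simp; ring

/-- Jensen's inequality for the log-determinant. -/
theorem log_det_one_add_le {F : Matrix (Fin d) (Fin d) ℝ} (hF : F.PosSemidef) :
    Real.log (1 + F).det ≤ F.rank * Real.log (1 + F.trace / F.rank) := by
  classical
  set lam := hF.isHermitian.eigenvalues with hlam
  have hnn : ∀ i, 0 ≤ lam i := hF.eigenvalues_nonneg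
  have hdet : (1 + F).det = ∏ i, (1 + lam i) := by
    simpa using det_smul_one_add_eq_prod hF.isHermitian 1
  have htr : F.trace = ∑ i, lam i := by simpa using hF.isHermitian.trace_eq_sum_eigenvalues
  -- Zero eigenvalues contribute log 1 = 0. Dropping them before applying Jensen replaces the
  -- dimension by the rank.
  set s := Finset.univ.filter fun i => lam i ≠ 0 with hs
  have hrk : F.rank = s.card := by
    rw [hF.isHermitian.rank_eq_card_non_zero_eigs, Fintype.card_subtype]
  have hlog : Real.log (1 + F).det = ∑ i ∈ s, Real.log (1 + lam i) := by
    rw [hdet, Real.log_prod (fun i _ => by linarith [hnn i] : ∀ i ∈ Finset.univ, 1 + lam i ≠ 0)]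
    symm
    refine Finset.sum_subset (Finset.filter_subset _ _) fun i _ hi => ?_
    have : lam i = 0 := by simpa [hs] using hi
    simp [this]
  have hsum : ∑ i, lam i = ∑ i ∈ s, lam i := by
    symm
    refine Finset.sum_subset (Finset.filter_subset _ _) fun i _ hi => ?_
    simpa [hs] using hi
  rcases Nat.eq_zero_or_pos s.card with h0 | hpos
  · rw [hlog, hrk, h0, Finset.card_eq_zero.1 h0]; simp
  have hr : (0 : ℝ) < s.card := by exact_mod_cast hpos
  rw [hlog, hrk, htr, hsum]
  have hJ := strictConcaveOn_log_Ioi.concaveOn.le_map_sum (t := s)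
    (w := fun _ => (1 : ℝ) / s.card) (p := fun i => 1 + lam i) (fun i _ => by positivity)
    (by simp [hr.ne']) (fun i _ => by simpa using (by linarith [hnn i] : 0 < 1 + lam i))
  simp only [smul_eq_mul, ← Finset.mul_sum] at hJ
  have e : 1 / (s.card : ℝ) * ∑ i ∈ s, (1 + lam i) = 1 + (∑ i ∈ s, lam i) / s.card := by
    rw [Finset.sum_add_distrib]; simp; field_simp
  rw [e] at hJ
  calc ∑ i ∈ s, Real.log (1 + lam i)
      = s.card * (1 / s.card * ∑ i ∈ s, Real.log (1 + lam i)) := by field_simp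
    _ ≤ _ := by gcongr

end LinearAlgebra


/-! ### Regret of a single η-expert as an online Newton step. -/

section Expert

variable {d : ℕ}

/-- The properties of the matrices of an expert with initial precision `c`. -/
structure Expert.Regular (c : ℝ) (e : Expert d) : Prop where
  lam_symm : e.Lamᵀ = e.Lam
  lam_ge : ∀ z, c * (z ⬝ᵥ z) ≤ z ⬝ᵥ (e.Lam *ᵥ z)
  lam_mul_sig : e.Lam * e.Sig = 1
  sig_symm : e.Sigᵀ = e.Sig
  det_pos : 0 < e.Lam.det
  sig_le : ∀ x, x ⬝ᵥ (e.Sig *ᵥ x) ≤ c⁻¹ * (x ⬝ᵥ x)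

theorem dotProduct_self_nonneg_real (z : Fin d → ℝ) : 0 ≤ z ⬝ᵥ z :=
  Finset.sum_nonneg fun i _ => mul_self_nonneg (z i)

theorem Expert.Regular.lam_nonneg {c : ℝ} (hc : 0 < c) {e : Expert d} (he : e.Regular c)
    (z : Fin d → ℝ) : 0 ≤ z ⬝ᵥ (e.Lam *ᵥ z) :=
  (mul_nonneg hc.le (dotProduct_self_nonneg_real z)).trans (he.lam_ge z)

theorem Expert.Regular.lam_mulVec_sig {c : ℝ} {e : Expert d} (he : e.Regular c)
    (z : Fin d → ℝ) : e.Lam *ᵥ (e.Sig *ᵥ z) = z := by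
  rw [Matrix.mulVec_mulVec, he.lam_mul_sig, Matrix.one_mulVec]

theorem Expert.Regular.sig_nonneg {c : ℝ} (hc : 0 < c) {e : Expert d} (he : e.Regular c)
    (z : Fin d → ℝ) : 0 ≤ z ⬝ᵥ (e.Sig *ᵥ z) := by
  have h := he.lam_nonneg hc (e.Sig *ᵥ z)
  rwa [he.lam_mulVec_sig, dotProduct_comm] at h

theorem Expert.regular_init {σ : ℝ} (hσ : σ ≠ 0) :
    (Expert.init σ : Expert d).Regular (1 / σ ^ 2) where
  lam_symm := by simp [Expert.init]
  lam_ge z := by simp [Expert.init, Matrix.smul_mulVec]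
  lam_mul_sig := by
    simp only [Expert.init, smul_mul_smul_comm, mul_one]
    rw [one_div_mul_cancel (pow_ne_zero 2 hσ), one_smul]
  sig_symm := by simp [Expert.init]
  det_pos := by
    simp only [Expert.init, Matrix.det_smul, Matrix.det_one, mul_one]
    positivity
  sig_le x := by simp [Expert.init, Matrix.smul_mulVec]

theorem Expert.update_Lam (η : ℝ) (e : Expert d) (K : Set (Fin d → ℝ)) (w g : Fin d → ℝ) :
    (e.update η K w g).Lam = e.Lam + (2 * η ^ 2) • Matrix.vecMulVec g g := rfl

theorem Expert.update_Sig (η : ℝ) (e : Expert d) (K : Set (Fin d → ℝ)) (w g : Fin d → ℝ) :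
    (e.update η K w g).Sig = e.Sig - (2 * η ^ 2 / (1 + 2 * η ^ 2 * (g ⬝ᵥ (e.Sig *ᵥ g)))) •
    Matrix.vecMulVec (e.Sig *ᵥ g) (g ᵥ* e.Sig) := rfl

theorem Expert.update_wcheck (η : ℝ) (e : Expert d) (K : Set (Fin d → ℝ)) (w g : Fin d → ℝ) :
    (e.update η K w g).wcheck = e.predict K -
      ((1 + 2 * η * ((e.predict K - w) ⬝ᵥ g)) * η) • ((e.update η K w g).Sig *ᵥ g) := rfl

theorem Expert.Regular.update_sig_quadratic {c : ℝ} {e : Expert d} (he : e.Regular c) (η : ℝ)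
    (K : Set (Fin d → ℝ)) (w g x : Fin d → ℝ) :
    x ⬝ᵥ ((e.update η K w g).Sig *ᵥ x) = x ⬝ᵥ (e.Sig *ᵥ x) -
      (2 * η ^ 2 / (1 + 2 * η ^ 2 * (g ⬝ᵥ (e.Sig *ᵥ g)))) * (x ⬝ᵥ (e.Sig *ᵥ g)) ^ 2 := by
  rw [Expert.update_Sig, ← Matrix.mulVec_transpose, he.sig_symm, Matrix.sub_mulVec,
    Matrix.smul_mulVec, dotProduct_sub, dotProduct_smul, dotProduct_vecMulVec_mulVec,
    dotProduct_comm (e.Sig *ᵥ g) x, smul_eq_mul, sq (x ⬝ᵥ _)]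

theorem Expert.Regular.update {c : ℝ} (hc : 0 < c) {e : Expert d} (he : e.Regular c) (η : ℝ)
    (K : Set (Fin d → ℝ)) (w g : Fin d → ℝ) : (e.update η K w g).Regular c := by
  have hg : 0 ≤ 2 * η ^ 2 * (g ⬝ᵥ (e.Sig *ᵥ g)) :=
    mul_nonneg (by positivity) (he.sig_nonneg hc g)
  refine ⟨?_, fun z => ?_, ?_, ?_, ?_, fun x => ?_⟩
  · rw [Expert.update_Lam, Matrix.transpose_add, Matrix.transpose_smul, he.lam_symm,
      transpose_vecMulVec_self]
  · rw [Expert.update_Lam, Matrix.add_mulVec, Matrix.smul_mulVec, dotProduct_add,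
      dotProduct_smul, dotProduct_vecMulVec_mulVec, smul_eq_mul, dotProduct_comm g z]
    have := he.lam_ge z
    have : 0 ≤ 2 * η ^ 2 * ((z ⬝ᵥ g) * (z ⬝ᵥ g)) :=
      mul_nonneg (by positivity) (mul_self_nonneg _)
    linarith
  · rw [Expert.update_Lam, Expert.update_Sig]
    exact sherman_morrison he.lam_mul_sig (by positivity)
  · rw [Expert.update_Sig, ← Matrix.mulVec_transpose, he.sig_symm, Matrix.transpose_sub,
      Matrix.transpose_smul, he.sig_symm, transpose_vecMulVec_self]
  · rw [Expert.update_Lam, det_add_smul_vecMulVec he.lam_mul_sig]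
    exact mul_pos he.det_pos (by positivity)
  · rw [he.update_sig_quadratic]
    have := he.sig_le x
    have : 0 ≤ 2 * η ^ 2 / (1 + 2 * η ^ 2 * (g ⬝ᵥ (e.Sig *ᵥ g))) * (x ⬝ᵥ (e.Sig *ᵥ g)) ^ 2 := by
      positivity
    linarith

theorem Expert.Regular.predict_mem {c : ℝ} (hc : 0 < c) {e : Expert d} (he : e.Regular c)
    {K : Set (Fin d → ℝ)} (hK : IsClosed K) (hne : K.Nonempty) : e.predict K ∈ K :=
  (project_spec hc he.lam_ge hK hne e.wcheck).1

/-- With y = gᵀΣg before the update, the left side equals 1 - 1/(1 + 2η²y), while the determinant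
grows by the factor 1 + 2η²y. -/
theorem Expert.Regular.update_log_det {c : ℝ} (hc : 0 < c) {e : Expert d} (he : e.Regular c)
    (η : ℝ) (K : Set (Fin d → ℝ)) (w g : Fin d → ℝ) :
    2 * η ^ 2 * (g ⬝ᵥ ((e.update η K w g).Sig *ᵥ g)) ≤
      Real.log (e.update η K w g).Lam.det - Real.log e.Lam.det := by
  rw [he.update_sig_quadratic, Expert.update_Lam, det_add_smul_vecMulVec he.lam_mul_sig]
  have hy := he.sig_nonneg hc g
  set y := g ⬝ᵥ (e.Sig *ᵥ g)
  have h1 : 0 < 1 + 2 * η ^ 2 * y := by positivity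
  rw [Real.log_mul he.det_pos.ne' h1.ne', add_sub_cancel_left]
  refine le_trans (le_of_eq ?_) (Real.one_sub_inv_le_log_of_pos h1)
  field_simp
  ring

/-- The second-order expansion of the surrogate at the prediction is exact. Its linear term cancels
the cross term of the new potential (since Λ'Σ'g = g), and its quadratic term cancels the growth of
Λ. What remains is half the squared step length, ½(1 + 2ηx)²η²G. -/
theorem surrogate_sub_add_quadratic_le {c : ℝ} (hc : 0 < c) {e : Expert d} (he : e.Regular c)
    {η : ℝ} {K : Set (Fin d → ℝ)} (hK : IsClosed K) (hconv : Convex ℝ K) {w g u : Fin d → ℝ}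
    (hu : u ∈ K) (hb : |η * ((e.predict K - w) ⬝ᵥ g)| ≤ 1 / 2) :
    surrogate η w g (e.predict K) - surrogate η w g u
      + 1 / 2 * ((u - (e.update η K w g).wcheck) ⬝ᵥ
          ((e.update η K w g).Lam *ᵥ (u - (e.update η K w g).wcheck)))
      ≤ 1 / 2 * ((u - e.wcheck) ⬝ᵥ (e.Lam *ᵥ (u - e.wcheck)))
        + 2 * η ^ 2 * (g ⬝ᵥ ((e.update η K w g).Sig *ᵥ g)) := by
  have he' := he.update hc η K w g
  have hproj : (u - e.predict K) ⬝ᵥ (e.Lam *ᵥ (u - e.predict K)) ≤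
      (u - e.wcheck) ⬝ᵥ (e.Lam *ᵥ (u - e.wcheck)) := by
    have h := project_spec hc he.lam_ge hK ⟨u, hu⟩ e.wcheck
    exact quadratic_sub_le_of_isMinOn he.lam_symm (he.lam_nonneg hc) hconv h.1 h.2 hu
  set y := e.predict K with hy
  set e' := e.update η K w g with he'def
  set x := (y - w) ⬝ᵥ g with hx
  set v := (u - y) ⬝ᵥ g with hv
  set G := g ⬝ᵥ (e'.Sig *ᵥ g) with hG
  have hG0 : 0 ≤ G := he'.sig_nonneg hc g
  have huw : (u - w) ⬝ᵥ g = x + v := by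
    rw [hx, hv, ← add_dotProduct]; congr 1; abel
  have hQ : (u - y) ⬝ᵥ (e'.Lam *ᵥ (u - y)) =
      (u - y) ⬝ᵥ (e.Lam *ᵥ (u - y)) + 2 * η ^ 2 * v ^ 2 := by
    rw [he'def, Expert.update_Lam, Matrix.add_mulVec, Matrix.smul_mulVec, dotProduct_add,
      dotProduct_smul, dotProduct_vecMulVec_mulVec, smul_eq_mul, dotProduct_comm g, ← hv, sq v]
  have hw : u - e'.wcheck = (u - y) + ((1 + 2 * η * x) * η) • (e'.Sig *ᵥ g) := by
    rw [he'def, Expert.update_wcheck]; abel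
  have hL : (e'.Sig *ᵥ g) ⬝ᵥ (e'.Lam *ᵥ (u - y)) = v := by
    rw [dotProduct_mulVec_symm he'.lam_symm, he'.lam_mulVec_sig]
  have hS : (e'.Sig *ᵥ g) ⬝ᵥ (e'.Lam *ᵥ (e'.Sig *ᵥ g)) = G := by
    rw [he'.lam_mulVec_sig, dotProduct_comm]
  rw [hw, quadratic_add he'.lam_symm, hL, hS, hQ, surrogate, surrogate, huw, ← hx]
  -- The bound |ηx| ≤ 1/2 puts 1 + 2ηx in [0, 2]; this gives the constant 2 in front of η²G.
  have hs : (1 + 2 * η * x) ^ 2 ≤ 4 := by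
    have := abs_le.1 hb
    nlinarith
  have : (1 + 2 * η * x) ^ 2 * (η ^ 2 * G) ≤ 4 * (η ^ 2 * G) :=
    mul_le_mul_of_nonneg_right hs (by positivity)
  nlinarith

theorem posSemidef_covariance (g : ℕ → Fin d → ℝ) (T : ℕ) : (covariance g T).PosSemidef :=
  Matrix.posSemidef_sum _ fun t _ => posSemidef_vecMulVec_self (g t)

theorem trace_covariance (g : ℕ → Fin d → ℝ) (T : ℕ) :
    (covariance g T).trace = ∑ t ∈ Finset.Icc 1 T, sqNorm (g t) := by
  simp [covariance, Matrix.trace_sum, Matrix.trace_vecMulVec, sqNorm_eq_dotProduct]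

/-- A run of the `η`-expert that is updated in the rounds `t` with `A t` only. -/
structure IsExpertRun (η σ : ℝ) (T : ℕ) (U : ℕ → Set (Fin d → ℝ)) (w g : ℕ → Fin d → ℝ)
    (A : Set ℕ) (e : ℕ → Expert d) : Prop where
  zero : e 0 = Expert.init σ
  succ_of_mem : ∀ t < T, t + 1 ∈ A →
    e (t + 1) = (e t).update η (U (t + 1)) (w (t + 1)) (g (t + 1))
  succ_of_notMem : ∀ t < T, t + 1 ∉ A → e (t + 1) = e t

namespace IsExpertRun

variable {η σ : ℝ} {T : ℕ} {U : ℕ → Set (Fin d → ℝ)} {w g : ℕ → Fin d → ℝ} {A : Set ℕ}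
  {e : ℕ → Expert d}

theorem regular (h : IsExpertRun η σ T U w g A e) (hσ : σ ≠ 0) :
    ∀ t ≤ T, (e t).Regular (1 / σ ^ 2) := by
  intro t
  induction t with
  | zero => intro _; rw [h.zero]; exact Expert.regular_init hσ
  | succ t ih =>
    intro ht
    have := ih (by omega)
    by_cases hA : t + 1 ∈ A
    · rw [h.succ_of_mem t ht hA]
      exact this.update (by positivity) ..
    · rwa [h.succ_of_notMem t ht hA]

open Classical in
-- Sum of the one-step inequality; the potential is constant in inactive rounds. Indices: `e (t -
-- 1)` predicts in round t, while `e t` already contains g_t.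
theorem sum_surrogate_sub_le (h : IsExpertRun η σ T U w g A e) (hσ : σ ≠ 0)
    (hclosed : ∀ t ∈ Finset.Icc 1 T, IsClosed (U t))
    (hconv : ∀ t ∈ Finset.Icc 1 T, Convex ℝ (U t)) {u : Fin d → ℝ}
    (hu : ∀ t ∈ Finset.Icc 1 T, u ∈ U t)
    (hb : ∀ t ∈ Finset.Icc 1 T, ∀ x ∈ U t, |η * ((x - w t) ⬝ᵥ g t)| ≤ 1 / 2) :
    ∑ t ∈ (Finset.Icc 1 T).filter (· ∈ A),
        (surrogate η (w t) (g t) ((e (t - 1)).predict (U t)) - surrogate η (w t) (g t) u)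
      ≤ 1 / 2 * (1 / σ ^ 2 * (u ⬝ᵥ u)) +
        ∑ t ∈ (Finset.Icc 1 T).filter (· ∈ A), 2 * η ^ 2 * (g t ⬝ᵥ ((e t).Sig *ᵥ g t)) := by
  have hc : 0 < 1 / σ ^ 2 := by positivity
  have key : ∀ n ≤ T, ∑ t ∈ (Finset.Icc 1 n).filter (· ∈ A),
        (surrogate η (w t) (g t) ((e (t - 1)).predict (U t)) - surrogate η (w t) (g t) u)
        + 1 / 2 * ((u - (e n).wcheck) ⬝ᵥ ((e n).Lam *ᵥ (u - (e n).wcheck)))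
      ≤ 1 / 2 * (1 / σ ^ 2 * (u ⬝ᵥ u)) +
        ∑ t ∈ (Finset.Icc 1 n).filter (· ∈ A), 2 * η ^ 2 * (g t ⬝ᵥ ((e t).Sig *ᵥ g t)) := by
    intro n
    induction n with
    | zero => intro _; simp [h.zero, Expert.init, Matrix.smul_mulVec]
    | succ n ih =>
      intro hn
      have hmem : n + 1 ∈ Finset.Icc 1 T := Finset.mem_Icc.2 ⟨by omega, hn⟩
      have ih := ih (by omega)
      have hreg := h.regular hσ n (by omega)
      simp only [Finset.sum_filter] at ih ⊢
      rw [Finset.sum_Icc_succ_top (by omega), Finset.sum_Icc_succ_top (by omega)]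
      by_cases hA : n + 1 ∈ A
      · have hstep := surrogate_sub_add_quadratic_le (w := w (n + 1)) (g := g (n + 1)) hc hreg
          (hclosed _ hmem) (hconv _ hmem)
          (hu _ hmem) (hb _ hmem _ (hreg.predict_mem hc (hclosed _ hmem) ⟨u, hu _ hmem⟩))
        rw [← h.succ_of_mem n hn hA] at hstep
        simp only [hA, if_true, Nat.add_sub_cancel]
        linarith
      · simp only [hA, if_false, add_zero]
        rwa [h.succ_of_notMem n hn hA]
  have := key T le_rfl
  have := (h.regular hσ T le_rfl).lam_nonneg hc (u - (e T).wcheck)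
  linarith

open Classical in
theorem sum_le_log_det_sub (h : IsExpertRun η σ T U w g A e) (hσ : σ ≠ 0) :
    ∀ n ≤ T, ∑ t ∈ (Finset.Icc 1 n).filter (· ∈ A), 2 * η ^ 2 * (g t ⬝ᵥ ((e t).Sig *ᵥ g t))
      ≤ Real.log (e n).Lam.det - Real.log (e 0).Lam.det := by
  have hc : 0 < 1 / σ ^ 2 := by positivity
  intro n
  induction n with
  | zero => simp
  | succ n ih =>
    intro hn
    have ih := ih (by omega)
    simp only [Finset.sum_filter] at ih ⊢
    rw [Finset.sum_Icc_succ_top (by omega)]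
    by_cases hA : n + 1 ∈ A
    · have := (h.regular hσ n (by omega)).update_log_det hc η (U (n + 1)) (w (n + 1)) (g (n + 1))
      rw [← h.succ_of_mem n hn hA] at this
      simp only [hA, if_true]
      linarith
    · simp only [hA, if_false, add_zero]
      rwa [h.succ_of_notMem n hn hA]

open Classical in
-- The covariance never exceeds its initial value σ²I, which gives a bound free of rank and
-- logarithm.
theorem sum_le_sum_sqNorm (h : IsExpertRun η σ T U w g A e) (hσ : σ ≠ 0) :
    ∑ t ∈ (Finset.Icc 1 T).filter (· ∈ A), 2 * η ^ 2 * (g t ⬝ᵥ ((e t).Sig *ᵥ g t))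
      ≤ 2 * η ^ 2 * σ ^ 2 * ∑ t ∈ Finset.Icc 1 T, sqNorm (g t) := by
  rw [Finset.mul_sum]
  refine (Finset.sum_le_sum fun t ht => ?_).trans
    (Finset.sum_le_sum_of_subset_of_nonneg (Finset.filter_subset _ _) fun t _ _ => ?_)
  · have := (h.regular hσ t (Finset.mem_Icc.1 (Finset.mem_filter.1 ht).1).2).sig_le (g t)
    rw [sqNorm_eq_dotProduct, mul_assoc (2 * η ^ 2)]
    simp only [one_div, inv_inv] at this
    gcongr
  · have : 0 ≤ sqNorm (g t) := sq_nonneg _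
    positivity

open Classical in
theorem lam_eq (h : IsExpertRun η σ T U w g A e) :
    ∀ n ≤ T, (e n).Lam = (1 / σ ^ 2) • (1 : Matrix (Fin d) (Fin d) ℝ) +
      (2 * η ^ 2) • ∑ t ∈ (Finset.Icc 1 n).filter (· ∈ A), Matrix.vecMulVec (g t) (g t) := by
  intro n
  induction n with
  | zero => simp [h.zero, Expert.init]
  | succ n ih =>
    intro hn
    have ih := ih (by omega)
    simp only [Finset.sum_filter] at ih ⊢
    rw [Finset.sum_Icc_succ_top (by omega)]
    by_cases hA : n + 1 ∈ A
    · rw [h.succ_of_mem n hn hA, Expert.update_Lam, ih]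
      simp only [hA, if_true, smul_add, add_assoc]
    · rw [h.succ_of_notMem n hn hA, ih]
      simp [hA]

open Classical in
theorem sum_le_rank_mul_log (h : IsExpertRun η σ T U w g A e) (hσ : σ ≠ 0) (hη : η ≠ 0) :
    ∑ t ∈ (Finset.Icc 1 T).filter (· ∈ A), 2 * η ^ 2 * (g t ⬝ᵥ ((e t).Sig *ᵥ g t))
      ≤ (covariance g T).rank * Real.log (1 + 2 * η ^ 2 * σ ^ 2 *
        (∑ t ∈ Finset.Icc 1 T, sqNorm (g t)) / (covariance g T).rank) := by
  refine (h.sum_le_log_det_sub hσ T le_rfl).trans ?_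
  have hreg := h.regular hσ T le_rfl
  have hc : 0 < 1 / σ ^ 2 := by positivity
  set F := covariance g T with hF
  set a := 2 * η ^ 2 * σ ^ 2 with ha
  have ha0 : 0 < a := by positivity
  have hPSD : ((e T).Lam).PosSemidef := by
    rw [h.lam_eq T le_rfl]
    exact ((Matrix.PosSemidef.one).smul hc.le).add ((Matrix.posSemidef_sum _ fun t _ =>
      posSemidef_vecMulVec_self (g t)).smul (by positivity))
  have hPD : ((e T).Lam).PosDef :=
    hPSD.posDef_iff_isUnit.2 ((Matrix.isUnit_iff_isUnit_det _).2 hreg.det_pos.ne'.isUnit)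
  have hdet := det_le_det_add_sum ((Finset.Icc 1 T).filter (¬ · ∈ A))
    (a := 2 * η ^ 2) (by positivity) g hPD
  have e1 : (e T).Lam + (2 * η ^ 2) • ∑ t ∈ (Finset.Icc 1 T).filter (¬ · ∈ A),
      Matrix.vecMulVec (g t) (g t) = (1 / σ ^ 2) • (1 + a • F) := by
    rw [h.lam_eq T le_rfl, add_assoc, ← smul_add, Finset.sum_filter_add_sum_filter_not,
      smul_add, smul_smul]
    congr 2
    rw [ha]; field_simp
  have e0 : (e 0).Lam.det = (1 / σ ^ 2) ^ d := by
    simp [h.zero, Expert.init]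
  have hpos : 0 < (1 + a • F).det :=
    (Matrix.PosDef.one.add_posSemidef ((posSemidef_covariance g T).smul ha0.le)).det_pos
  rw [e1, Matrix.det_smul, Fintype.card_fin] at hdet
  have hlog := Real.log_le_log hreg.det_pos hdet
  rw [Real.log_mul (by positivity) hpos.ne', ← e0] at hlog
  have hfin := log_det_one_add_le ((posSemidef_covariance g T).smul ha0.le)
  rw [Matrix.rank_smul_of_mem_nonZeroDivisors F (mem_nonZeroDivisors_of_ne_zero ha0.ne'),
    Matrix.trace_smul, trace_covariance, ← hF, smul_eq_mul] at hfin
  linarith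

end IsExpertRun

end Expert


/-! ### A scalar exponential inequality and counting grid points. -/

section Analysis

theorem exp_neg_sub_sq_le {y : ℝ} (hy : y ≤ 1 / 2) : Real.exp (-(y + y ^ 2)) ≤ 1 - y := by
  have h1 : 0 < 1 - y := by linarith
  rw [← Real.le_log_iff_exp_le h1]
  rcases le_or_gt y 0 with h0 | h0
  · refine le_trans ?_ (Real.one_sub_inv_le_log_of_pos h1)
    have : 1 - (1 - y)⁻¹ - -(y + y ^ 2) = -y ^ 3 / (1 - y) := by field_simp; ring
    have h3 : 0 ≤ -y ^ 3 / (1 - y) := by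
      refine div_nonneg ?_ h1.le
      nlinarith [mul_nonneg (neg_nonneg.2 h0) (sq_nonneg y)]
    linarith
  -- Four Taylor terms are needed: with three, the remainder bound is already too weak at y = 1/2.
  · have h := Real.abs_log_sub_add_sum_range_le (x := y) (by rw [abs_of_pos h0]; linarith) 4
    rw [abs_of_pos h0] at h
    have h2 := (abs_le.1 h).1
    have h3 : y ^ 5 / (1 - y) ≤ 2 * y ^ 5 := by
      rw [div_le_iff₀ h1]
      have e : 2 * y ^ 5 * (1 - y) - y ^ 5 = 2 * (y ^ 5 * (1 / 2 - y)) := by ring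
      have := mul_nonneg (pow_pos h0 5).le (sub_nonneg.2 hy)
      linarith
    simp only [Finset.sum_range_succ, Finset.sum_range_zero] at h2
    norm_num at h2
    have h4 : y ^ 3 / 3 + y ^ 4 / 4 + 2 * y ^ 5 ≤ y ^ 2 / 2 := by
      have a1 : y ^ 3 ≤ y ^ 2 / 2 := by nlinarith [sq_nonneg y]
      have a2 : y ^ 4 ≤ y ^ 2 / 4 := by nlinarith [sq_nonneg y]
      have a3 : y ^ 5 ≤ y ^ 2 / 8 := by nlinarith [sq_nonneg y]
      linarith [sq_nonneg y]
    linarith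

theorem grid_pos {η : ℝ} (h : η ∈ grid) : 0 < η := by
  obtain ⟨i, rfl⟩ := h
  positivity

/-- The number of elements of the grid in a half-open interval. -/
theorem exists_finset_grid {x y : ℝ} (hx : 0 < x) (hy : 0 < y) :
    ∃ F : Finset ℝ, (F : Set ℝ) = grid ∩ Set.Ioc x y ∧
      (F.card : ℤ) ≤ ceilPos (Real.logb 2 (y / x)) := by
  classical
  refine ⟨(Finset.Ioc ⌊Real.logb 2 x⌋ ⌊Real.logb 2 y⌋).image fun i : ℤ => (2 : ℝ) ^ i, ?_, ?_⟩
  · ext η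
    simp only [Finset.coe_image, Finset.coe_Ioc, Set.mem_image, Set.mem_Ioc, Set.mem_inter_iff,
      grid, Set.mem_range]
    have h1 : ∀ i : ℤ, ⌊Real.logb 2 x⌋ < i ↔ x < (2 : ℝ) ^ i := fun i => by
      rw [Int.floor_lt, Real.logb_lt_iff_lt_rpow one_lt_two hx, Real.rpow_intCast]
    have h2 : ∀ i : ℤ, i ≤ ⌊Real.logb 2 y⌋ ↔ (2 : ℝ) ^ i ≤ y := fun i => by
      rw [Int.le_floor, Real.le_logb_iff_rpow_le one_lt_two hy, Real.rpow_intCast]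
    constructor
    · rintro ⟨i, hi, rfl⟩
      exact ⟨⟨i, rfl⟩, (h1 i).1 hi.1, (h2 i).1 hi.2⟩
    · rintro ⟨⟨i, rfl⟩, hi⟩
      exact ⟨i, ⟨(h1 i).2 hi.1, (h2 i).2 hi.2⟩, rfl⟩
  · refine (Int.ofNat_le.2 Finset.card_image_le).trans ?_
    rw [Int.card_Ioc, Int.ofNat_toNat, ceilPos, Real.logb_div hy.ne' hx.ne']
    refine max_le_max ?_ zero_le_one
    -- A difference of floors is less than the real difference plus one; integrality then gives the
    -- ceiling without an extra unit.
    rw [← Int.lt_add_one_iff]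
    have h1 := Int.floor_le (Real.logb 2 y)
    have h2 := Int.lt_floor_add_one (Real.logb 2 x)
    have h3 := Int.le_ceil (Real.logb 2 y - Real.logb 2 x)
    have : ((⌊Real.logb 2 y⌋ - ⌊Real.logb 2 x⌋ : ℤ) : ℝ) <
        ((⌈Real.logb 2 y - Real.logb 2 x⌉ + 1 : ℤ) : ℝ) := by
      push_cast; linarith
    exact_mod_cast this

theorem one_le_ceilPos (z : ℝ) : 1 ≤ ceilPos z := le_max_right _ _

theorem ceilPos_mono {x y : ℝ} (h : x ≤ y) : ceilPos x ≤ ceilPos y :=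
  max_le_max (Int.ceil_mono h) le_rfl

end Analysis

/-! ### Running maxima and sums of clipped range bounds. -/

section RunMax

variable {b : ℕ → ℝ}

theorem runMax_succ (b : ℕ → ℝ) (t : ℕ) : runMax b (t + 1) = max (runMax b t) (b (t + 1)) := rfl

theorem runMax_mono (b : ℕ → ℝ) : Monotone (runMax b) :=
  monotone_nat_of_le_succ fun _ => le_max_left _ _

theorem runMax_nonneg (b : ℕ → ℝ) (t : ℕ) : 0 ≤ runMax b t := runMax_mono b (Nat.zero_le t)

theorem le_runMax (b : ℕ → ℝ) {t : ℕ} (ht : 1 ≤ t) : b t ≤ runMax b t := by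
  obtain ⟨t, rfl⟩ := Nat.exists_eq_add_of_le' ht
  exact le_max_right _ _

/-- The range bound after clipping. -/
def clippedBound (b : ℕ → ℝ) (t : ℕ) : ℝ := b t * (runMax b (t - 1) / runMax b t)

theorem clippedBound_nonneg {t : ℕ} (hb : 0 ≤ b t) : 0 ≤ clippedBound b t :=
  mul_nonneg hb (div_nonneg (runMax_nonneg _ _) (runMax_nonneg _ _))

theorem ratio_nonneg {t : ℕ} (hb : 0 ≤ b t) : 0 ≤ b t / runMax b t :=
  div_nonneg hb (runMax_nonneg _ _)

theorem ratio_le_one {t : ℕ} (ht : 1 ≤ t) : b t / runMax b t ≤ 1 :=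
  div_le_one_of_le₀ (le_runMax b ht) (runMax_nonneg _ _)

theorem clippedBound_eq (b : ℕ → ℝ) (t : ℕ) :
    clippedBound b t = b t / runMax b t * runMax b (t - 1) := by
  rw [clippedBound]; ring

theorem clippedBound_le {t : ℕ} (ht : 1 ≤ t) : clippedBound b t ≤ runMax b (t - 1) := by
  rw [clippedBound_eq]
  exact mul_le_of_le_one_left (runMax_nonneg _ _) (ratio_le_one ht)

/-- The first round with a positive bound has b = B and contributes a full 1. -/
theorem one_le_sum_ratio {T : ℕ} (hb : ∀ t ∈ Finset.Icc 1 T, 0 ≤ b t) :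
    ∀ n ≤ T, 0 < runMax b n → 1 ≤ ∑ s ∈ Finset.Icc 1 n, b s / runMax b s := by
  intro n
  induction n with
  | zero => intro _ h; exact absurd h (lt_irrefl _)
  | succ n ih =>
    intro hn hpos
    rw [Finset.sum_Icc_succ_top (by omega)]
    rcases (runMax_nonneg b n).eq_or_lt with h0 | h0
    · have e : runMax b (n + 1) = b (n + 1) := by
        rw [runMax_succ, ← h0] at hpos ⊢
        rcases lt_max_iff.1 hpos with h | h
        · exact absurd h (lt_irrefl _)
        · exact max_eq_right h.le
      rw [← e, div_self hpos.ne']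
      have : 0 ≤ ∑ s ∈ Finset.Icc 1 n, b s / runMax b s := Finset.sum_nonneg fun s hs =>
        ratio_nonneg (hb s (Finset.Icc_subset_Icc_right (by omega) hs))
      linarith
    · have := ih (by omega) h0
      have := ratio_nonneg (hb (n + 1) (Finset.mem_Icc.2 ⟨by omega, hn⟩))
      linarith

/-- In the induction the increment of B appears with coefficient 1 on the left and with the sum of
ratios, at least 1, on the right. -/
theorem sum_clippedBound_add_le {T : ℕ} (hb : ∀ t ∈ Finset.Icc 1 T, 0 ≤ b t) :
    ∀ n ≤ T, ∑ s ∈ Finset.Icc 1 n, clippedBound b s + runMax b n ≤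
      runMax b n * ∑ s ∈ Finset.Icc 1 n, b s / runMax b s := by
  intro n
  induction n with
  | zero => intro _; simp [runMax]
  | succ n ih =>
    intro hn
    have ih := ih (by omega)
    have hone := one_le_sum_ratio hb (n + 1) hn
    rw [Finset.sum_Icc_succ_top (by omega)] at hone ⊢
    rw [Finset.sum_Icc_succ_top (by omega), clippedBound_eq, Nat.add_sub_cancel]
    set r := b (n + 1) / runMax b (n + 1) with hr
    set R := ∑ s ∈ Finset.Icc 1 n, b s / runMax b s
    have hr0 : 0 ≤ r := ratio_nonneg (hb (n + 1) (Finset.mem_Icc.2 ⟨by omega, hn⟩))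
    have hle := runMax_mono b (Nat.le_add_right n 1)
    have hBn := runMax_nonneg b n
    rcases (runMax_nonneg b (n + 1)).eq_or_lt with h0 | h0
    · have h1 : runMax b n = 0 := le_antisymm (h0 ▸ hle) hBn
      rw [h1] at ih
      rw [h1, ← h0]
      linarith
    · have := hone h0
      nlinarith

theorem sum_clippedBound_le {T : ℕ} (hb : ∀ t ∈ Finset.Icc 1 T, 0 ≤ b t) {n : ℕ} (hn : n ≤ T) :
    ∑ s ∈ Finset.Icc 1 n, clippedBound b s ≤
      runMax b n * ∑ s ∈ Finset.Icc 1 n, b s / runMax b s := by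
  have := sum_clippedBound_add_le hb n hn
  have := runMax_nonneg b n
  linarith

end RunMax

/-! ### When a learning rate is active. -/

section Active

variable {b : ℕ → ℝ}

/-- The reciprocal of twice the lower end of the interval of active learning rates. -/
def activeRange (b : ℕ → ℝ) (t : ℕ) : ℝ :=
  ∑ s ∈ Finset.Ico 1 t, clippedBound b s + runMax b (t - 1)

theorem mem_active {t : ℕ} {η : ℝ} : η ∈ active b t ↔
    0 < runMax b (t - 1) ∧ η ∈ grid ∧ 1 / (2 * activeRange b t) < η ∧
      η ≤ 1 / (2 * runMax b (t - 1)) := by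
  unfold active activeRange clippedBound
  split_ifs with h
  · simp [h]
  · have : 0 < runMax b (t - 1) := lt_of_le_of_ne (runMax_nonneg _ _) (Ne.symm h)
    simp only [Set.mem_inter_iff, Set.mem_Ioc, this, true_and]

theorem runMax_le_activeRange {T t : ℕ} (hb : ∀ t ∈ Finset.Icc 1 T, 0 ≤ b t) (ht : t ≤ T) :
    runMax b (t - 1) ≤ activeRange b t := by
  have : 0 ≤ ∑ s ∈ Finset.Ico 1 t, clippedBound b s := Finset.sum_nonneg fun s hs =>
    clippedBound_nonneg (hb s (by simp at hs ⊢; omega))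
  unfold activeRange
  linarith

theorem activeRange_mono {T s t : ℕ} (hb : ∀ t ∈ Finset.Icc 1 T, 0 ≤ b t) (hst : s ≤ t)
    (ht : t ≤ T) : activeRange b s ≤ activeRange b t := by
  refine add_le_add (Finset.sum_le_sum_of_subset_of_nonneg
    (Finset.Ico_subset_Ico_right hst) fun i hi _ => ?_) (runMax_mono b (by omega))
  exact clippedBound_nonneg (hb i (by simp at hi ⊢; omega))

theorem activeRange_inv_anti {T s t : ℕ} (hb : ∀ t ∈ Finset.Icc 1 T, 0 ≤ b t) (hst : s ≤ t)
    (ht : t ≤ T) (hs : 0 < runMax b (s - 1)) :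
    1 / (2 * activeRange b t) ≤ 1 / (2 * activeRange b s) := by
  have h1 := runMax_le_activeRange hb (hst.trans ht)
  have h2 := activeRange_mono hb hst ht
  exact one_div_le_one_div_of_le (by linarith) (by linarith)

/-- The lower threshold only decreases, so an active rate can be lost only by exceeding the upper
one. -/
theorem mem_active_of_le {T s t : ℕ} (hb : ∀ t ∈ Finset.Icc 1 T, 0 ≤ b t) (hst : s ≤ t)
    (ht : t ≤ T) {η : ℝ} (hη : η ∈ active b s) (hle : η ≤ 1 / (2 * runMax b (t - 1))) :
    η ∈ active b t := by
  rw [mem_active] at hη ⊢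
  exact ⟨hη.1.trans_le (runMax_mono b (by omega)), hη.2.1,
    (activeRange_inv_anti hb hst ht hη.1).trans_lt hη.2.2.1, hle⟩

theorem le_of_le_runMax {s t : ℕ} (hst : s ≤ t) {η : ℝ} (hs : 0 < runMax b s)
    (hη : η ≤ 1 / (2 * runMax b t)) : η ≤ 1 / (2 * runMax b s) := by
  have := runMax_mono b hst
  exact hη.trans (one_div_le_one_div_of_le (by linarith) (by linarith))

/-- The clipped range bounds of the rounds in which `η` is not active. -/
theorem sum_inactive_le {T : ℕ} (hb : ∀ t ∈ Finset.Icc 1 T, 0 ≤ b t) {η : ℝ} (hη : η ∈ grid)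
    (hle : η ≤ 1 / (2 * runMax b T)) [DecidablePred fun t => η ∈ active b t] :
    ∀ n ≤ T, ∑ t ∈ Finset.Icc 1 n, (if η ∈ active b t then 0 else clippedBound b t)
      ≤ 1 / (2 * η) := by
  have hη0 := grid_pos hη
  intro n
  induction n with
  | zero => intro _; simp; positivity
  | succ n ih =>
    intro hn
    have ih := ih (by omega)
    rw [Finset.sum_Icc_succ_top (by omega)]
    by_cases hA : η ∈ active b (n + 1)
    · simpa [hA] using ih
    rw [if_neg hA]
    rcases (runMax_nonneg b n).eq_or_lt with h0 | h0
    · simpa [clippedBound, ← h0] using ih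
    · rw [mem_active] at hA
      -- As η ≤ 1/(2B_T), inactivity can only mean that η is still below the lower threshold. The
      -- clipped bounds up to this round then sum to at most `activeRange`, which is at most 1/(2η).
      have h1 : η ≤ 1 / (2 * activeRange b (n + 1)) := by
        by_contra hlt
        exact hA ⟨h0, hη, not_le.1 hlt, le_of_le_runMax (by omega) h0 hle⟩
      have h2 := runMax_le_activeRange hb hn
      simp only [Nat.add_sub_cancel] at h2
      have hr : 0 < 2 * activeRange b (n + 1) := by linarith
      have h3 : 2 * activeRange b (n + 1) ≤ 1 / η := by
        rw [le_div_iff₀ hη0]; rw [le_div_iff₀ hr] at h1; linarith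
      have h4 : ∑ t ∈ Finset.Icc 1 n, (if η ∈ active b t then 0 else clippedBound b t)
          ≤ ∑ t ∈ Finset.Icc 1 n, clippedBound b t := Finset.sum_le_sum fun t ht => by
        split_ifs
        · exact clippedBound_nonneg (hb t (Finset.Icc_subset_Icc_right (by omega) ht))
        · exact le_rfl
      have h5 : clippedBound b (n + 1) ≤ runMax b n := clippedBound_le (by omega)
      have h6 : activeRange b (n + 1) = ∑ s ∈ Finset.Icc 1 n, clippedBound b s + runMax b n := rfl
      have h7 : 1 / (2 * η) = 1 / η / 2 := by ring
      rw [h7]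
      linarith

end Active


/-! ### Exponential weights over the learning rates, with resets. -/

section Controller

variable {d : ℕ}

theorem active_finite (b : ℕ → ℝ) {T t : ℕ} (hb : ∀ t ∈ Finset.Icc 1 T, 0 ≤ b t) (ht : t ≤ T) :
    (active b t).Finite := by
  by_cases h : 0 < runMax b (t - 1)
  · have h1 := runMax_le_activeRange hb ht
    obtain ⟨F, hF, -⟩ := exists_finset_grid (x := 1 / (2 * activeRange b t))
      (y := 1 / (2 * runMax b (t - 1))) (one_div_pos.2 (by linarith)) (by positivity)
    exact F.finite_toSet.subset fun η hη => by
      rw [hF]; exact (mem_active.1 hη).2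
  · convert Set.finite_empty
    exact Set.eq_empty_of_forall_notMem fun η hη => h (mem_active.1 hη).1

/-- The controller averages with weights pη rather than p precisely so that the linear parts of the
surrogates cancel here. -/
theorem State.sum_weighted_eq_zero {S : State d} {F : Finset ℝ} (hF : F.Nonempty)
    (hpos : ∀ η ∈ F, 0 < S.p η * η) (K : Set (Fin d → ℝ)) (v : Fin d → ℝ) :
    ∑ η ∈ F, S.p η * η * (((S.expert η).predict K - S.predict F K) ⬝ᵥ v) = 0 := by
  have hW : 0 < ∑ η ∈ F, S.p η * η := Finset.sum_pos hpos hF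
  have hne : (F : Set ℝ) ≠ ∅ := by simpa using hF.ne_empty
  simp only [sub_dotProduct, mul_sub, Finset.sum_sub_distrib, ← Finset.sum_mul]
  rw [State.predict, if_neg hne, finsum_mem_coe_finset, finsum_mem_coe_finset, smul_dotProduct,
    smul_eq_mul, mul_inv_cancel_left₀ hW.ne', sum_dotProduct]
  simp [smul_dotProduct]

theorem State.sum_mul_exp_le {S : State d} {F : Finset ℝ} (hp : ∀ η ∈ F, 0 < S.p η)
    (hη : ∀ η ∈ F, 0 < η) (K : Set (Fin d → ℝ)) (v : Fin d → ℝ)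
    (hb : ∀ η ∈ F, η * (((S.expert η).predict K - S.predict F K) ⬝ᵥ v) ≤ 1 / 2) :
    ∑ η ∈ F, S.p η * Real.exp (-surrogate η (S.predict F K) v ((S.expert η).predict K)) ≤
      ∑ η ∈ F, S.p η := by
  rcases F.eq_empty_or_nonempty with rfl | hF
  · simp
  have h0 := State.sum_weighted_eq_zero hF (fun η h => mul_pos (hp η h) (hη η h)) K v
  calc _ ≤ ∑ η ∈ F, (S.p η - S.p η * η * (((S.expert η).predict K - S.predict F K) ⬝ᵥ v)) := by
        refine Finset.sum_le_sum fun η h => ?_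
        have := mul_le_mul_of_nonneg_left (exp_neg_sub_sq_le (hb η h)) (hp η h).le
        rw [surrogate]
        linarith
    _ = _ := by rw [Finset.sum_sub_distrib, h0, sub_zero]

/-- The prediction of the `η`-expert in round `t`. -/
def expertPredict (σ : ℝ → ℝ) (U : ℕ → Set (Fin d → ℝ)) (g : ℕ → Fin d → ℝ) (b : ℕ → ℝ) (η : ℝ)
    (t : ℕ) : Fin d → ℝ :=
  ((state σ U g b (t - 1)).expert η).predict (U t)

open Classical in
/-- The negative clipped surrogate loss of the `η`-expert if it is active, and `0` otherwise. -/
def clippedGain (σ : ℝ → ℝ) (U : ℕ → Set (Fin d → ℝ)) (g : ℕ → Fin d → ℝ) (b : ℕ → ℝ) (η : ℝ)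
    (t : ℕ) : ℝ :=
  if η ∈ active b t then
    -surrogate η (iterate σ U g b t) ((runMax b (t - 1) / runMax b t) • g t)
      (expertPredict σ U g b η t)
  else 0

/-- The bounds `b t` are valid for the predictions of the active experts. -/
structure IsBounded (σ : ℝ → ℝ) (U : ℕ → Set (Fin d → ℝ)) (g : ℕ → Fin d → ℝ) (b : ℕ → ℝ)
    (T : ℕ) : Prop where
  nonneg : ∀ t ∈ Finset.Icc 1 T, 0 ≤ b t
  range : ∀ t ∈ Finset.Icc 1 T, ∀ η ∈ active b t,
    |(expertPredict σ U g b η t - iterate σ U g b t) ⬝ᵥ g t| ≤ b t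

variable {σ : ℝ → ℝ} {U : ℕ → Set (Fin d → ℝ)} {g : ℕ → Fin d → ℝ} {b : ℕ → ℝ} {T : ℕ}

theorem abs_dotProduct_clipped_le {x : Fin d → ℝ} {t : ℕ} (h : |x ⬝ᵥ g t| ≤ b t) :
    |x ⬝ᵥ ((runMax b (t - 1) / runMax b t) • g t)| ≤ clippedBound b t := by
  have hc : 0 ≤ runMax b (t - 1) / runMax b t :=
    div_nonneg (runMax_nonneg _ _) (runMax_nonneg _ _)
  rw [dotProduct_smul, smul_eq_mul, abs_mul, abs_of_nonneg hc, clippedBound, mul_comm]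
  gcongr

namespace IsBounded

theorem clippedGain_le (h : IsBounded σ U g b T) {t : ℕ} (ht : t ∈ Finset.Icc 1 T) {η : ℝ}
    (hη : 0 < η) : clippedGain σ U g b η t ≤ η * clippedBound b t := by
  unfold clippedGain
  split_ifs with hA
  · have := neg_le_of_abs_le (abs_dotProduct_clipped_le (h.range t ht η hA))
    rw [surrogate]
    nlinarith [sq_nonneg (η * ((expertPredict σ U g b η t - iterate σ U g b t) ⬝ᵥ
      ((runMax b (t - 1) / runMax b t) • g t)))]
  · exact mul_nonneg hη.le (clippedBound_nonneg (h.nonneg t ht))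

/-- This is why gradients are clipped: activity controls η by B_{t-1} only, and clipping brings the
range down from B_t to B_{t-1}. -/
theorem mul_dotProduct_le (h : IsBounded σ U g b T) {t : ℕ} (ht : t ∈ Finset.Icc 1 T) {η : ℝ}
    (hA : η ∈ active b t) :
    η * ((expertPredict σ U g b η t - iterate σ U g b t) ⬝ᵥ
      ((runMax b (t - 1) / runMax b t) • g t)) ≤ 1 / 2 := by
  have h1 := le_of_abs_le (abs_dotProduct_clipped_le (h.range t ht η hA))
  have h2 := h1.trans (clippedBound_le (Finset.mem_Icc.1 ht).1)
  obtain ⟨hB, hg, -, hle⟩ := mem_active.1 hA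
  have hη := grid_pos hg
  calc _ ≤ η * runMax b (t - 1) := by gcongr
    _ ≤ 1 / (2 * runMax b (t - 1)) * runMax b (t - 1) := by gcongr
    _ = 1 / 2 := by field_simp

end IsBounded

theorem state_succ (t : ℕ) : state σ U g b (t + 1) =
    (state σ U g b t).step b (t + 1) (U (t + 1)) (g (t + 1)) := rfl

theorem state_τ_of_reset {t : ℕ} (hr : ResetNeeded b (state σ U g b t).τ (t + 1)) :
    (state σ U g b (t + 1)).τ = t + 1 := by
  rw [state_succ, State.step]; exact if_pos hr

theorem state_τ_of_not_reset {t : ℕ} (hr : ¬ ResetNeeded b (state σ U g b t).τ (t + 1)) :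
    (state σ U g b (t + 1)).τ = (state σ U g b t).τ := by
  rw [state_succ, State.step]; exact if_neg hr

theorem state_p_of_notMem {t : ℕ} {η : ℝ} (hA : η ∉ active b (t + 1)) :
    (state σ U g b (t + 1)).p η = (state σ U g b t).p η := by
  rw [state_succ, State.step]; exact if_neg hA

theorem state_p_of_reset {t : ℕ} (hr : ResetNeeded b (state σ U g b t).τ (t + 1)) {η : ℝ}
    (hA : η ∈ active b (t + 1)) : (state σ U g b (t + 1)).p η = 1 := by
  rw [state_succ, State.step]; exact (if_pos hA).trans (if_pos hr)

theorem exp_clippedGain {t : ℕ} {η : ℝ} (hA : η ∈ active b (t + 1)) :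
    Real.exp (clippedGain σ U g b η (t + 1)) = Real.exp (-surrogate η
      ((state σ U g b t).predict (active b (t + 1)) (U (t + 1)))
      ((runMax b t / runMax b (t + 1)) • g (t + 1))
      (((state σ U g b t).expert η).predict (U (t + 1)))) := by
  rw [clippedGain, if_pos hA]; rfl

theorem state_p_of_mem {t : ℕ} (hr : ¬ ResetNeeded b (state σ U g b t).τ (t + 1)) {F : Finset ℝ}
    (hF : (F : Set ℝ) = active b (t + 1)) {η : ℝ} (hA : η ∈ active b (t + 1)) :
    (state σ U g b (t + 1)).p η =
      (state σ U g b t).p η * Real.exp (clippedGain σ U g b η (t + 1)) /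
        (∑ θ ∈ F, (state σ U g b t).p θ * Real.exp (clippedGain σ U g b θ (t + 1))) *
        ∑ θ ∈ F, (state σ U g b t).p θ := by
  have e : ∑ θ ∈ F, (state σ U g b t).p θ * Real.exp (clippedGain σ U g b θ (t + 1)) =
      ∑ᶠ θ ∈ active b (t + 1), (state σ U g b t).p θ * Real.exp (-surrogate θ
      ((state σ U g b t).predict (active b (t + 1)) (U (t + 1)))
      ((runMax b t / runMax b (t + 1)) • g (t + 1))
      (((state σ U g b t).expert θ).predict (U (t + 1)))) := by
    rw [← hF, finsum_mem_coe_finset]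
    refine Finset.sum_congr rfl fun θ hθ => ?_
    rw [exp_clippedGain (hF ▸ hθ), hF]
  rw [e, exp_clippedGain hA, ← finsum_mem_coe_finset, hF, state_succ, State.step]
  exact (if_pos hA).trans (if_neg hr)

theorem state_p_pos (hb : ∀ t ∈ Finset.Icc 1 T, 0 ≤ b t) :
    ∀ n ≤ T, ∀ η, 0 < (state σ U g b n).p η := by
  intro n
  induction n with
  | zero => intro _ η; exact one_pos
  | succ n ih =>
    intro hn η
    have ih := ih (by omega)
    by_cases hA : η ∈ active b (n + 1)
    · by_cases hr : ResetNeeded b (state σ U g b n).τ (n + 1)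
      · rw [state_p_of_reset hr hA]; exact one_pos
      · obtain ⟨F, hF⟩ := (active_finite b hb hn).exists_finset_coe
        have hne : F.Nonempty := ⟨η, by rw [← Finset.mem_coe, hF]; exact hA⟩
        rw [state_p_of_mem hr hF hA]
        exact mul_pos (div_pos (mul_pos (ih η) (Real.exp_pos _))
          (Finset.sum_pos (fun θ _ => mul_pos (ih θ) (Real.exp_pos _)) hne))
          (Finset.sum_pos (fun θ _ => ih θ) hne)
    · rw [state_p_of_notMem hA]; exact ih η

theorem state_p_of_never_active {η : ℝ} :
    ∀ n, (∀ s ∈ Finset.Icc 1 n, η ∉ active b s) → (state σ U g b n).p η = 1 := by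
  intro n
  induction n with
  | zero => intro _; rfl
  | succ n ih =>
    intro h
    rw [state_p_of_notMem (h (n + 1) (by simp))]
    exact ih fun s hs => h s (Finset.Icc_subset_Icc_right (by omega) hs)

theorem state_τ_le : ∀ n, (state σ U g b n).τ ≤ n := by
  intro n
  induction n with
  | zero => exact le_rfl
  | succ n ih =>
    by_cases hr : ResetNeeded b (state σ U g b n).τ (n + 1)
    · rw [state_τ_of_reset hr]
    · rw [state_τ_of_not_reset hr]; omega

/-- After a reset all learning rates that are not too large have weight one. -/
theorem state_p_after_reset (hb : ∀ t ∈ Finset.Icc 1 T, 0 ≤ b t) {n : ℕ} (hn : n + 1 ≤ T)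
    (hr : ResetNeeded b (state σ U g b n).τ (n + 1)) {η : ℝ}
    (hle : η ≤ 1 / (2 * runMax b (n + 1))) : (state σ U g b (n + 1)).p η = 1 := by
  by_cases hA : η ∈ active b (n + 1)
  · exact state_p_of_reset hr hA
  rw [state_p_of_notMem hA]
  -- Had η been active earlier, it would be active now, being below the current upper threshold. So
  -- it has never started and still has weight 1.
  refine state_p_of_never_active n fun s hs hs' => hA ?_
  have hs1 := Finset.mem_Icc.1 hs
  refine mem_active_of_le hb (by omega) hn hs' (le_of_le_runMax (Nat.le_succ n) ?_ hle)
  exact (mem_active.1 hs').1.trans_le (runMax_mono b (by omega))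

/-- Without a reset this is the failed reset test. Just after a reset τ = n, and the sum of ratios
is at least 1 unless B_n = 0. -/
theorem runMax_le_of_epoch (hb : ∀ t ∈ Finset.Icc 1 T, 0 ≤ b t) :
    ∀ n ≤ T, runMax b n ≤
      runMax b (state σ U g b n).τ * ∑ s ∈ Finset.Icc 1 n, b s / runMax b s := by
  intro n hn
  rcases n with _ | n
  · simp [runMax]
  by_cases hr : ResetNeeded b (state σ U g b n).τ (n + 1)
  · rw [state_τ_of_reset hr]
    rcases (runMax_nonneg b (n + 1)).eq_or_lt with h0 | h0
    · simp [← h0]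
    · exact le_mul_of_one_le_right h0.le (one_le_sum_ratio hb _ hn h0)
  · rw [state_τ_of_not_reset hr]
    exact not_lt.1 hr

theorem sum_mul_exp_clippedGain_le (h : IsBounded σ U g b T) {n : ℕ} (hn : n + 1 ≤ T)
    {F : Finset ℝ} (hF : (F : Set ℝ) = active b (n + 1)) :
    ∑ θ ∈ F, (state σ U g b n).p θ * Real.exp (clippedGain σ U g b θ (n + 1)) ≤
      ∑ θ ∈ F, (state σ U g b n).p θ := by
  have hmem : ∀ θ ∈ F, θ ∈ active b (n + 1) := fun θ hθ => hF ▸ hθ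
  have h1 := State.sum_mul_exp_le (S := state σ U g b n) (F := F)
    (fun θ _ => state_p_pos h.nonneg n (by omega) θ)
    (fun θ hθ => grid_pos (mem_active.1 (hmem θ hθ)).2.1) (U (n + 1))
    ((runMax b n / runMax b (n + 1)) • g (n + 1)) (fun θ hθ => by
      rw [hF]
      exact h.mul_dotProduct_le (Finset.mem_Icc.2 ⟨by omega, hn⟩) (hmem θ hθ))
  rw [hF] at h1
  refine le_trans (le_of_eq (Finset.sum_congr rfl fun θ hθ => ?_)) h1
  rw [exp_clippedGain (hmem θ hθ)]

/-- At a reset every rate in F has weight 1, and normalization preserves the mass of the active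
rates. Rates not yet started also count with weight 1, so a single F serves the whole epoch. -/
theorem sum_state_p_eq_card (hb : ∀ t ∈ Finset.Icc 1 T, 0 ≤ b t) :
    ∀ n ≤ T, ∀ F : Finset ℝ, (∀ η ∈ F, η ≤ 1 / (2 * runMax b (state σ U g b n).τ)) →
      (∀ s ∈ Finset.Ioc (state σ U g b n).τ n, active b s ⊆ F) →
      ∑ η ∈ F, (state σ U g b n).p η = F.card := by
  intro n
  induction n with
  | zero => intro _ F _ _; simp [state, State.init]
  | succ n ih =>
    intro hn F hle hsub
    by_cases hr : ResetNeeded b (state σ U g b n).τ (n + 1)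
    · rw [state_τ_of_reset hr] at hle
      rw [Finset.sum_congr rfl fun η hη => state_p_after_reset hb hn hr (hle η hη)]
      simp
    · rw [state_τ_of_not_reset hr] at hle hsub
      have ih := ih (by omega) F hle fun s hs => hsub s (by simp at hs ⊢; omega)
      have hτ : (state σ U g b n).τ ≤ n := state_τ_le n
      have hA : active b (n + 1) ⊆ F := hsub (n + 1) (by simp; omega)
      obtain ⟨G, hG⟩ := (active_finite b hb hn).exists_finset_coe
      have hGF : G ⊆ F := by rw [← Finset.coe_subset, hG]; exact hA
      rw [← ih, ← Finset.sum_sdiff hGF, ← Finset.sum_sdiff hGF]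
      congr 1
      · refine Finset.sum_congr rfl fun η hη => state_p_of_notMem ?_
        rw [← hG]; exact (Finset.mem_sdiff.1 hη).2
      · rcases G.eq_empty_or_nonempty with rfl | hne
        · simp
        rw [Finset.sum_congr rfl fun η hη => state_p_of_mem hr hG (hG ▸ hη), ← Finset.sum_mul,
          ← Finset.sum_div, div_self, one_mul]
        exact (Finset.sum_pos (fun θ _ => mul_pos (state_p_pos hb n (by omega) θ)
          (Real.exp_pos _)) hne).ne'

/-- The sum of ratios, at most n, enters twice: from `activeRange` to B_n and from B_n to B_τ. The
square becomes the 2 in 2 log₂ T. -/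
theorem activeRange_le_of_epoch (hb : ∀ t ∈ Finset.Icc 1 T, 0 ≤ b t) {n : ℕ} (hn : n ≤ T) :
    activeRange b (n + 1) ≤ runMax b (state σ U g b n).τ * (n : ℝ) ^ 2 := by
  have h1 := sum_clippedBound_add_le hb n hn
  have h2 := runMax_le_of_epoch (σ := σ) (U := U) (g := g) hb n hn
  set R := ∑ s ∈ Finset.Icc 1 n, b s / runMax b s with hR
  have hR0 : 0 ≤ R := Finset.sum_nonneg fun s hs =>
    ratio_nonneg (hb s (Finset.Icc_subset_Icc_right hn hs))
  have hRn : R ≤ n := by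
    calc R ≤ ∑ s ∈ Finset.Icc 1 n, (1 : ℝ) :=
          Finset.sum_le_sum fun s hs => ratio_le_one (Finset.mem_Icc.1 hs).1
      _ = n := by simp
  have hτ := runMax_nonneg b (state σ U g b n).τ
  calc activeRange b (n + 1) ≤ runMax b n * R := h1
    _ ≤ runMax b (state σ U g b n).τ * R * R := by gcongr
    _ = runMax b (state σ U g b n).τ * R ^ 2 := by ring
    _ ≤ _ := by gcongr

/-- The number of learning rates that are active at some time of an epoch. -/
theorem exists_finset_epoch (hb : ∀ t ∈ Finset.Icc 1 T, 0 ≤ b t) {n : ℕ} (hn : n + 1 ≤ T)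
    (hpos : 0 < runMax b n) :
    ∃ F : Finset ℝ, (∀ η ∈ F, η ≤ 1 / (2 * runMax b (state σ U g b n).τ)) ∧
      (∀ s ∈ Finset.Ioc (state σ U g b n).τ (n + 1), active b s ⊆ F) ∧
      (F.card : ℝ) ≤ ceilPos (2 * Real.logb 2 T) := by
  -- If B_τ were 0, the positive B_n would already have forced a reset.
  have hτ : 0 < runMax b (state σ U g b n).τ := by
    by_contra h0
    have h1 := runMax_le_of_epoch (σ := σ) (U := U) (g := g) hb n (by omega)
    rw [le_antisymm (not_lt.1 h0) (runMax_nonneg _ _), zero_mul] at h1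
    linarith
  have hr := runMax_le_activeRange hb hn
  simp only [Nat.add_sub_cancel] at hr
  have hr0 : 0 < activeRange b (n + 1) := hpos.trans_le hr
  obtain ⟨F, hF, hcard⟩ := exists_finset_grid (x := 1 / (2 * activeRange b (n + 1)))
    (y := 1 / (2 * runMax b (state σ U g b n).τ)) (by positivity) (by positivity)
  have hmem : ∀ η, η ∈ F ↔ η ∈ grid ∧ 1 / (2 * activeRange b (n + 1)) < η ∧
      η ≤ 1 / (2 * runMax b (state σ U g b n).τ) := fun η => by
    rw [← Finset.mem_coe, hF]; rfl
  refine ⟨F, fun η hη => ((hmem η).1 hη).2.2, fun s hs η hη => ?_, ?_⟩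
  · have hs := Finset.mem_Ioc.1 hs
    obtain ⟨h1, h2, h3, h4⟩ := mem_active.1 hη
    exact (hmem η).2 ⟨h2, (activeRange_inv_anti hb hs.2 hn h1).trans_lt h3,
      le_of_le_runMax (by omega) hτ h4⟩
  · have hratio : 1 / (2 * runMax b (state σ U g b n).τ) / (1 / (2 * activeRange b (n + 1))) =
        activeRange b (n + 1) / runMax b (state σ U g b n).τ := by field_simp
    rw [hratio] at hcard
    have h1 : Real.logb 2 (activeRange b (n + 1) / runMax b (state σ U g b n).τ) ≤
        2 * Real.logb 2 T := by
      rw [show 2 * Real.logb 2 (T : ℝ) = Real.logb 2 ((T : ℝ) ^ 2) by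
        rw [Real.logb_pow]; norm_num]
      refine Real.logb_le_logb_of_le one_lt_two (by positivity) ?_
      rw [div_le_iff₀ hτ, mul_comm]
      refine (activeRange_le_of_epoch (σ := σ) (U := U) (g := g) hb (by omega)).trans ?_
      have : (n : ℝ) ≤ T := by exact_mod_cast (by omega : n ≤ T)
      gcongr
    exact_mod_cast hcard.trans (ceilPos_mono h1)

/-- Also covers a reset round, in which the exponential update is discarded but the gain still has
to be paid for. -/
theorem mul_exp_clippedGain_le (h : IsBounded σ U g b T) {n : ℕ} (hn : n + 1 ≤ T) {η : ℝ}
    (hA : η ∈ active b (n + 1)) :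
    (state σ U g b n).p η * Real.exp (clippedGain σ U g b η (n + 1)) ≤
      ceilPos (2 * Real.logb 2 T) := by
  obtain ⟨F, hle, hsub, hcard⟩ := exists_finset_epoch (σ := σ) (U := U) (g := g) h.nonneg hn
    (mem_active.1 hA).1
  have hτ : (state σ U g b n).τ ≤ n := state_τ_le n
  obtain ⟨G, hG⟩ := (active_finite b h.nonneg hn).exists_finset_coe
  have hGF : G ⊆ F := by
    rw [← Finset.coe_subset, hG]; exact hsub (n + 1) (by simp; omega)
  have hp := state_p_pos (σ := σ) (U := U) (g := g) h.nonneg n (by omega)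
  calc _ ≤ ∑ θ ∈ G, (state σ U g b n).p θ * Real.exp (clippedGain σ U g b θ (n + 1)) :=
        Finset.single_le_sum (f := fun θ => (state σ U g b n).p θ *
          Real.exp (clippedGain σ U g b θ (n + 1)))
          (fun θ _ => (mul_pos (hp θ) (Real.exp_pos _)).le)
          (by rw [← Finset.mem_coe, hG]; exact hA)
    _ ≤ ∑ θ ∈ G, (state σ U g b n).p θ := sum_mul_exp_clippedGain_le h hn hG
    _ ≤ ∑ θ ∈ F, (state σ U g b n).p θ :=
        Finset.sum_le_sum_of_subset_of_nonneg hGF fun θ _ _ => (hp θ).le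
    _ = F.card := sum_state_p_eq_card h.nonneg n (by omega) F hle
        fun s hs => hsub s (by simp at hs ⊢; omega)
    _ ≤ _ := hcard

theorem log_state_p_add_le (h : IsBounded σ U g b T) {n : ℕ} (hn : n + 1 ≤ T) {η : ℝ}
    (hA : η ∈ active b (n + 1)) :
    Real.log ((state σ U g b n).p η) + clippedGain σ U g b η (n + 1) ≤
      Real.log (ceilPos (2 * Real.logb 2 T)) := by
  have hp := state_p_pos (σ := σ) (U := U) (g := g) h.nonneg n (by omega) η
  have h1 := Real.log_le_log (mul_pos hp (Real.exp_pos _)) (mul_exp_clippedGain_le h hn hA)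
  rwa [Real.log_mul hp.ne' (Real.exp_pos _).ne', Real.log_exp] at h1

/-- The potential does not increase, so normalization multiplies each active weight by a factor of
at least 1. -/
theorem log_state_p_add_le_log_succ (h : IsBounded σ U g b T) {n : ℕ} (hn : n + 1 ≤ T)
    (hr : ¬ ResetNeeded b (state σ U g b n).τ (n + 1)) (η : ℝ) :
    Real.log ((state σ U g b n).p η) + clippedGain σ U g b η (n + 1) ≤
      Real.log ((state σ U g b (n + 1)).p η) := by
  by_cases hA : η ∈ active b (n + 1)
  · have hp := state_p_pos (σ := σ) (U := U) (g := g) h.nonneg n (by omega)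
    obtain ⟨G, hG⟩ := (active_finite b h.nonneg hn).exists_finset_coe
    have hne : G.Nonempty := ⟨η, by rw [← Finset.mem_coe, hG]; exact hA⟩
    have hq : 0 < ∑ θ ∈ G, (state σ U g b n).p θ * Real.exp (clippedGain σ U g b θ (n + 1)) :=
      Finset.sum_pos (fun θ _ => mul_pos (hp θ) (Real.exp_pos _)) hne
    have hpη : 0 < (state σ U g b n).p η * Real.exp (clippedGain σ U g b η (n + 1)) :=
      mul_pos (hp η) (Real.exp_pos _)
    rw [← Real.log_exp (clippedGain σ U g b η (n + 1)),
      ← Real.log_mul (hp η).ne' (Real.exp_pos _).ne', state_p_of_mem hr hG hA]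
    refine Real.log_le_log hpη ?_
    rw [div_mul_eq_mul_div, le_div_iff₀ hq]
    exact mul_le_mul_of_nonneg_left (sum_mul_exp_clippedGain_le h hn hG) hpη.le
  · rw [state_p_of_notMem hA, clippedGain, if_neg hA, add_zero]

theorem log_ceilPos_nonneg (z : ℝ) : 0 ≤ Real.log (ceilPos z) :=
  Real.log_nonneg (by exact_mod_cast one_le_ceilPos z)

/-- The gains of the `η`-expert in the current epoch and in the epochs before it. -/
theorem sum_clippedGain_epochs (h : IsBounded σ U g b T) {η : ℝ} (hη : η ∈ grid)
    (hle : η ≤ 1 / (2 * runMax b T)) :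
    ∀ n ≤ T,
      ∑ s ∈ Finset.Ioc (state σ U g b n).τ n, clippedGain σ U g b η s ≤
          Real.log ((state σ U g b n).p η) ∧
      ∑ s ∈ Finset.Ioc (state σ U g b n).τ n, clippedGain σ U g b η s ≤
          Real.log (ceilPos (2 * Real.logb 2 T)) ∧
      ∑ s ∈ Finset.Ioc 0 (state σ U g b n).τ, clippedGain σ U g b η s ≤
          η * runMax b n + Real.log (ceilPos (2 * Real.logb 2 T)) := by
  have hη0 := grid_pos hη
  have hN := log_ceilPos_nonneg (2 * Real.logb 2 T)
  intro n
  induction n with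
  | zero =>
    intro _
    simpa [state, State.init, runMax] using hN
  | succ n ih =>
    intro hn
    obtain ⟨ih1, ih2, ih3⟩ := ih (by omega)
    have hτ : (state σ U g b n).τ ≤ n := state_τ_le n
    have hsum : ∑ s ∈ Finset.Ioc (state σ U g b n).τ (n + 1), clippedGain σ U g b η s =
        ∑ s ∈ Finset.Ioc (state σ U g b n).τ n, clippedGain σ U g b η s +
          clippedGain σ U g b η (n + 1) := Finset.sum_Ioc_succ_top hτ _
    have hcur : ∑ s ∈ Finset.Ioc (state σ U g b n).τ (n + 1), clippedGain σ U g b η s ≤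
        Real.log (ceilPos (2 * Real.logb 2 T)) := by
      rw [hsum]
      by_cases hA : η ∈ active b (n + 1)
      · have := log_state_p_add_le h hn hA
        linarith
      · rw [clippedGain, if_neg hA]
        linarith
    by_cases hr : ResetNeeded b (state σ U g b n).τ (n + 1)
    · have hB : 0 < runMax b (n + 1) := by
        refine lt_of_le_of_lt (mul_nonneg (runMax_nonneg b _) ?_) hr
        exact Finset.sum_nonneg fun s hs => ratio_nonneg (h.nonneg s (by simp at hs ⊢; omega))
      rw [state_τ_of_reset hr, state_p_after_reset h.nonneg hn hr (le_of_le_runMax hn hB hle)]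
      refine ⟨by simp, by simpa using hN, ?_⟩
      -- At a reset the epoch just finished, including this round, costs ln N by `hcur`. Everything
      -- before it costs at most ηB_τ times the sum of ratios, which the reset test bounds by
      -- ηB_{n+1}; the logarithms of older epochs do not accumulate.
      rw [← Finset.sum_Ioc_consecutive _ (Nat.zero_le _) (hτ.trans (Nat.le_succ n))]
      refine add_le_add ?_ hcur
      have hτT : (state σ U g b n).τ ≤ T := by omega
      calc ∑ s ∈ Finset.Icc 1 (state σ U g b n).τ, clippedGain σ U g b η s
          ≤ ∑ s ∈ Finset.Icc 1 (state σ U g b n).τ, η * clippedBound b s :=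
            Finset.sum_le_sum fun s hs =>
              h.clippedGain_le (Finset.Icc_subset_Icc_right hτT hs) hη0
        _ = η * ∑ s ∈ Finset.Icc 1 (state σ U g b n).τ, clippedBound b s := by
            rw [Finset.mul_sum]
        _ ≤ η * runMax b (n + 1) := by
            refine mul_le_mul_of_nonneg_left ?_ hη0.le
            refine (sum_clippedBound_le h.nonneg hτT).trans (le_trans ?_ (le_of_lt hr))
            refine mul_le_mul_of_nonneg_left ?_ (runMax_nonneg b _)
            exact Finset.sum_le_sum_of_subset_of_nonneg
              (Finset.Icc_subset_Icc_right (by omega)) fun s hs _ =>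
                ratio_nonneg (h.nonneg s (Finset.Icc_subset_Icc_right hn hs))
    · rw [state_τ_of_not_reset hr]
      refine ⟨?_, hcur, ih3.trans ?_⟩
      · have := log_state_p_add_le_log_succ h hn hr η
        linarith
      · have := mul_le_mul_of_nonneg_left (runMax_mono b (Nat.le_succ n)) hη0.le
        linarith

theorem sum_clippedGain_le (h : IsBounded σ U g b T) {η : ℝ} (hη : η ∈ grid)
    (hle : η ≤ 1 / (2 * runMax b T)) :
    ∑ s ∈ Finset.Icc 1 T, clippedGain σ U g b η s ≤
      η * runMax b T + 2 * Real.log (ceilPos (2 * Real.logb 2 T)) := by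
  obtain ⟨-, h2, h3⟩ := sum_clippedGain_epochs h hη hle T le_rfl
  have : ∑ s ∈ Finset.Icc 1 T, clippedGain σ U g b η s =
      ∑ s ∈ Finset.Ioc 0 (state σ U g b T).τ, clippedGain σ U g b η s +
        ∑ s ∈ Finset.Ioc (state σ U g b T).τ T, clippedGain σ U g b η s :=
    (Finset.sum_Ioc_consecutive _ (Nat.zero_le _) (state_τ_le T)).symm
  linarith

end Controller


/-! ### Combining the regrets and choosing the learning rate. -/

section Regret

variable {d : ℕ}

theorem exists_grid_le {V Z B : ℝ} (hV : 0 ≤ V) (hZ : 0 < Z) (hB : 0 < B) :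
    ∃ η ∈ grid, η ≤ 1 / (2 * B) ∧
      η * V + Z / η ≤ 5 / 2 * Real.sqrt (V * Z) + 5 * B * Z := by
  have hgrid : ∀ x : ℝ, 0 < x → ∃ η ∈ grid, η ≤ x ∧ x < 2 * η := fun x hx => by
    obtain ⟨n, h1, h2⟩ := exists_mem_Ico_zpow hx (one_lt_two (α := ℝ))
    refine ⟨2 ^ n, ⟨n, rfl⟩, h1, ?_⟩
    rwa [zpow_add_one₀ two_ne_zero, mul_comm] at h2
  have hsq : Real.sqrt (V * Z) = Real.sqrt V * Real.sqrt Z := Real.sqrt_mul hV Z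
  have hs0 : 0 < Real.sqrt Z := Real.sqrt_pos.2 hZ
  have hv0 : 0 ≤ Real.sqrt V := Real.sqrt_nonneg V
  have hsV : Real.sqrt V * Real.sqrt V = V := Real.mul_self_sqrt hV
  have hsZ : Real.sqrt Z * Real.sqrt Z = Z := Real.mul_self_sqrt hZ.le
  set s := Real.sqrt Z
  set v := Real.sqrt V
  rw [hsq, ← hsV, ← hsZ]
  -- This decides whether the optimum s/v = √(Z/V) is admissible. If so, rounding it down to the
  -- grid loses a factor of at most 2, and 5/2 = 2 + 1/2 is the worst case. If not, 1/(2B) is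
  -- rounded down instead.
  by_cases hc : 2 * B * s ≤ v
  · have hv : 0 < v := lt_of_lt_of_le (by positivity) hc
    obtain ⟨η, hη, h1, h2⟩ := hgrid (s / v) (by positivity)
    have hη0 := grid_pos hη
    refine ⟨η, hη, h1.trans ?_, ?_⟩
    · rw [div_le_div_iff₀ hv (by positivity)]; linarith
    · rw [le_div_iff₀ hv] at h1
      rw [div_lt_iff₀ hv] at h2
      have h3 : η * (v * v) + s * s / η ≤ 5 / 2 * (v * s) := by
        rw [← sub_nonneg]
        have : 5 / 2 * (v * s) - (η * (v * v) + s * s / η) =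
            (2 * η * v - s) * (2 * s - η * v) / (2 * η) := by
          field_simp; ring
        rw [this]
        exact div_nonneg (mul_nonneg (by linarith) (by linarith)) (by positivity)
      have : 0 ≤ 5 * B * (s * s) := by positivity
      linarith
  · obtain ⟨η, hη, h1, h2⟩ := hgrid (1 / (2 * B)) (by positivity)
    have hη0 := grid_pos hη
    refine ⟨η, hη, h1, ?_⟩
    have hc := (not_le.1 hc).le
    have h3 : η * (2 * B) ≤ 1 := by rwa [le_div_iff₀ (by positivity)] at h1
    have h4 : s * s / η ≤ 4 * B * (s * s) := by
      rw [div_lt_iff₀ (by positivity)] at h2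
      rw [div_le_iff₀ hη0]
      nlinarith [mul_pos hs0 hs0]
    have h5 : η * (v * v) ≤ v * s := by
      calc η * (v * v) ≤ η * (v * (2 * B * s)) := by gcongr
        _ = (η * (2 * B)) * (v * s) := by ring
        _ ≤ 1 * (v * s) := by gcongr
        _ = v * s := one_mul _
    have : 0 ≤ B * (s * s) := by positivity
    have : 0 ≤ v * s := by positivity
    linarith

theorem mul_one_sub_le {b : ℕ → ℝ} {t : ℕ} (ht : 1 ≤ t) (hb : 0 ≤ b t) :
    b t * (1 - runMax b (t - 1) / runMax b t) ≤ runMax b t - runMax b (t - 1) := by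
  have h1 := le_runMax b ht
  have h2 := runMax_mono b (Nat.sub_le t 1)
  rcases (runMax_nonneg b t).eq_or_lt with h0 | h0
  · have : b t = 0 := le_antisymm (h0 ▸ h1) hb
    rw [this]; linarith
  · have h3 : 0 ≤ 1 - runMax b (t - 1) / runMax b t := sub_nonneg.2 (div_le_one_of_le₀ h2 h0.le)
    calc _ ≤ runMax b t * (1 - runMax b (t - 1) / runMax b t) := by gcongr
      _ = _ := by field_simp

theorem sum_runMax_sub (b : ℕ → ℝ) (n : ℕ) :
    ∑ t ∈ Finset.Icc 1 n, (runMax b t - runMax b (t - 1)) = runMax b n := by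
  induction n with
  | zero => simp [runMax]
  | succ n ih => rw [Finset.sum_Icc_succ_top (by omega), ih]; simp

/-- The effect of clipping on the surrogate loss. -/
theorem neg_surrogate_le_clipped {b : ℕ → ℝ} {t : ℕ} (ht : 1 ≤ t) (hb : 0 ≤ b t) {η : ℝ}
    (hη : 0 < η) {y w g : Fin d → ℝ} (h : |(y - w) ⬝ᵥ g| ≤ b t) :
    -surrogate η w g y ≤ -surrogate η w ((runMax b (t - 1) / runMax b t) • g) y +
      η * (runMax b t - runMax b (t - 1)) := by
  have hc0 : 0 ≤ runMax b (t - 1) / runMax b t :=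
    div_nonneg (runMax_nonneg _ _) (runMax_nonneg _ _)
  have hc1 : runMax b (t - 1) / runMax b t ≤ 1 :=
    div_le_one_of_le₀ (runMax_mono b (Nat.sub_le t 1)) (runMax_nonneg _ _)
  have hm := mul_one_sub_le ht hb
  rw [surrogate, surrogate, dotProduct_smul, smul_eq_mul]
  set c := runMax b (t - 1) / runMax b t
  set x := (y - w) ⬝ᵥ g
  have h1 : -x * (1 - c) ≤ b t * (1 - c) :=
    mul_le_mul_of_nonneg_right (neg_le_of_neg_le (neg_le_of_abs_le h)) (by linarith)
  have h2 : (η * (c * x)) ^ 2 ≤ (η * x) ^ 2 := by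
    have : c ^ 2 ≤ 1 := pow_le_one₀ hc0 hc1
    nlinarith [mul_nonneg (sub_nonneg.2 this) (sq_nonneg (η * x))]
  have h3 := mul_le_mul_of_nonneg_left (h1.trans hm) hη.le
  linarith

theorem isExpertRun_state {σ : ℝ → ℝ} {U : ℕ → Set (Fin d → ℝ)} {w g : ℕ → Fin d → ℝ}
    {b : ℕ → ℝ} {T : ℕ} (hw : ∀ t ∈ Finset.Icc 1 T, w t = iterate σ U g b t) (η : ℝ) :
    IsExpertRun η (σ η) T U w g {t | η ∈ active b t} fun t => (state σ U g b t).expert η where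
  zero := rfl
  succ_of_mem t ht hA := by
    rw [hw (t + 1) (Finset.mem_Icc.2 ⟨by omega, ht⟩)]
    simp only [state_succ, State.step]
    exact if_pos hA
  succ_of_notMem t _ hA := by
    simp only [state_succ, State.step]
    exact if_neg hA

theorem IsPlay.bound_nonneg {T : ℕ} {U : ℕ → Set (Fin d → ℝ)} {f : ℕ → (Fin d → ℝ) → ℝ}
    {w g : ℕ → Fin d → ℝ} {b : ℕ → ℝ} (hplay : IsPlay T U f w g b) :
    ∀ t ∈ Finset.Icc 1 T, 0 ≤ b t := fun t ht =>
  (abs_nonneg _).trans (hplay.range_bound t ht 0 (hplay.zero_mem t ht))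

section

variable {σ : ℝ → ℝ} {T : ℕ} {U : ℕ → Set (Fin d → ℝ)} {f : ℕ → (Fin d → ℝ) → ℝ}
  {w g : ℕ → Fin d → ℝ} {b : ℕ → ℝ}

theorem IsPlay.expertPredict_mem (hplay : IsPlay T U f w g b)
    (hw : ∀ t ∈ Finset.Icc 1 T, w t = iterate σ U g b t) {η : ℝ} (hσ : σ η ≠ 0) :
    ∀ t ∈ Finset.Icc 1 T, expertPredict σ U g b η t ∈ U t := fun t ht => by
  have h := (isExpertRun_state hw η).regular hσ (t - 1) (by simp at ht; omega)
  exact h.predict_mem (by positivity) (hplay.isClosed t ht) ⟨0, hplay.zero_mem t ht⟩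

theorem IsPlay.isBounded (hplay : IsPlay T U f w g b)
    (hw : ∀ t ∈ Finset.Icc 1 T, w t = iterate σ U g b t) (hσ : ∀ η, 0 < η → σ η ≠ 0) :
    IsBounded σ U g b T where
  nonneg := hplay.bound_nonneg
  range t ht η hA := by
    rw [← hw t ht]
    exact hplay.range_bound t ht _
      (hplay.expertPredict_mem hw (hσ η (grid_pos (mem_active.1 hA).2.1)) t ht)

open Classical in
-- In an active round the expert's prediction is inserted and its gain clipped. In an inactive round
-- the regret is at most b_t, which is the clipped bound plus at most the increment of B.
theorem mul_regret_le (hplay : IsPlay T U f w g b)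
    (hw : ∀ t ∈ Finset.Icc 1 T, w t = iterate σ U g b t) (hσ : ∀ η, 0 < η → σ η ≠ 0)
    {u : Fin d → ℝ} (hu : ∀ t ∈ Finset.Icc 1 T, u ∈ U t) {η : ℝ} (hη : 0 < η)
    {t : ℕ} (ht : t ∈ Finset.Icc 1 T) :
    η * ((w t - u) ⬝ᵥ g t) ≤ η ^ 2 * ((u - w t) ⬝ᵥ g t) ^ 2 +
      η * (if η ∈ active b t then 0 else clippedBound b t) +
      (if η ∈ active b t then surrogate η (w t) (g t) (expertPredict σ U g b η t) -
        surrogate η (w t) (g t) u else 0) +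
      clippedGain σ U g b η t + η * (runMax b t - runMax b (t - 1)) := by
  have ht1 := (Finset.mem_Icc.1 ht).1
  have hb := hplay.bound_nonneg t ht
  have hneg : (w t - u) ⬝ᵥ g t = -((u - w t) ⬝ᵥ g t) := by rw [← neg_sub, neg_dotProduct]
  rw [hneg]
  by_cases hA : η ∈ active b t
  · have h1 := neg_surrogate_le_clipped ht1 hb hη (hplay.range_bound t ht _
      (hplay.expertPredict_mem hw (hσ η hη) t ht))
    rw [clippedGain, if_pos hA, if_pos hA, if_pos hA, ← hw t ht]
    have h2 : surrogate η (w t) (g t) u =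
      η * ((u - w t) ⬝ᵥ g t) + (η * ((u - w t) ⬝ᵥ g t)) ^ 2 := rfl
    rw [h2]
    linarith
  · rw [clippedGain, if_neg hA, if_neg hA, if_neg hA]
    have h1 := neg_le_of_neg_le (neg_le_of_abs_le (hplay.range_bound t ht u (hu t ht)))
    have h2 := mul_one_sub_le ht1 hb
    have h3 : -((u - w t) ⬝ᵥ g t) ≤ clippedBound b t + (runMax b t - runMax b (t - 1)) := by
      rw [clippedBound]; linarith
    have h4 := mul_le_mul_of_nonneg_left h3 hη.le
    have : 0 ≤ η ^ 2 * ((u - w t) ⬝ᵥ g t) ^ 2 := by positivity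
    linarith

/-- The regret bound for one learning rate, in terms of a bound `E` for the sum of the squared
dual norms of the gradients. -/
theorem regret_le_of_grid {α : ℝ} (hα : 0 < α) (hplay : IsPlay T U f w g b)
    (hw : ∀ t ∈ Finset.Icc 1 T, w t = iterate (fun η => 1 / Real.sqrt (α * η)) U g b t)
    (hB : 0 < runMax b T)
    {u : Fin d → ℝ} (hu : ∀ t ∈ Finset.Icc 1 T, u ∈ U t) {η : ℝ} (hη : η ∈ grid)
    (hle : η ≤ 1 / (2 * runMax b T)) :
    linRegret w g T u ≤ η * variance w g T u +
      ((covariance g T).rank * Real.log (1 + (∑ t ∈ Finset.Icc 1 T, sqNorm (g t)) /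
        (runMax b T * α * (covariance g T).rank)) + lowZ T) / η
        + α / 2 * sqNorm u + 2 * runMax b T ∧
    linRegret w g T u ≤ η * variance w g T u + lowZ T / η +
      2 / α * ∑ t ∈ Finset.Icc 1 T, sqNorm (g t) + α / 2 * sqNorm u + 2 * runMax b T := by
  classical
  have hη0 := grid_pos hη
  set σ : ℝ → ℝ := fun η => 1 / Real.sqrt (α * η) with hσdef
  have hσ : ∀ η, 0 < η → σ η ≠ 0 := fun η h => by
    have : 0 < α * η := by positivity
    simp only [hσdef]
    positivity
  have hσsq : σ η ^ 2 = 1 / (α * η) := by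
    simp only [hσdef, div_pow, one_pow]
    rw [Real.sq_sqrt (by positivity)]
  have hbdd : IsBounded σ U g b T := hplay.isBounded hw hσ
  have hrun := isExpertRun_state hw η
  have hsmall : ∀ t ∈ Finset.Icc 1 T, ∀ x ∈ U t, |η * ((x - w t) ⬝ᵥ g t)| ≤ 1 / 2 := by
    intro t ht x hx
    have h1 : |(x - w t) ⬝ᵥ g t| ≤ runMax b T := (hplay.range_bound t ht x hx).trans
      ((le_runMax b (Finset.mem_Icc.1 ht).1).trans (runMax_mono b (Finset.mem_Icc.1 ht).2))
    rw [abs_mul, abs_of_pos hη0]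
    calc _ ≤ 1 / (2 * runMax b T) * runMax b T := by gcongr
      _ = 1 / 2 := by field_simp
  have hexp := hrun.sum_surrogate_sub_le (hσ η hη0) hplay.isClosed hplay.convex hu hsmall
  have hE1 := hrun.sum_le_rank_mul_log (hσ η hη0) hη0.ne'
  have hE2 := hrun.sum_le_sum_sqNorm (hσ η hη0)
  set E := ∑ t ∈ (Finset.Icc 1 T).filter (· ∈ {t | η ∈ active b t}),
    2 * η ^ 2 * (g t ⬝ᵥ (((state σ U g b t).expert η).Sig *ᵥ g t)) with hE
  set Q := ∑ t ∈ Finset.Icc 1 T, sqNorm (g t) with hQ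
  have hQ0 : 0 ≤ Q := Finset.sum_nonneg fun t _ => sq_nonneg _
  have hmain : η * linRegret w g T u ≤ η ^ 2 * variance w g T u + E + lowZ T
      + η * (α / 2 * sqNorm u + 2 * runMax b T) := by
    have hsum := Finset.sum_le_sum fun t ht => mul_regret_le hplay hw hσ hu hη0 ht
    simp only [Finset.sum_add_distrib, ← Finset.mul_sum] at hsum
    rw [sum_runMax_sub, ← Finset.sum_filter] at hsum
    -- The inactive rounds supply the 1/2 in `lowZ`, and the controller its 2 ln N. The two terms
    -- ηB_T come from the early epochs and from clipping.
    have h1 := sum_inactive_le hbdd.nonneg hη hle T le_rfl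
    have h2 := sum_clippedGain_le hbdd hη hle
    have h3 := mul_le_mul_of_nonneg_left h1 hη0.le
    have h4 : η * (1 / (2 * η)) = 1 / 2 := by field_simp
    rw [hσsq, ← sqNorm_eq_dotProduct] at hexp
    -- Taking σ² = 1/(αη) makes the cost of the initial potential proportional to η, so that it
    -- becomes α/2·‖u‖² for every rate.
    have h5 : 1 / 2 * (1 / (1 / (α * η)) * sqNorm u) = η * (α / 2 * sqNorm u) := by
      field_simp
    rw [h5] at hexp
    rw [h4] at h3
    have hexp' : ∑ t ∈ (Finset.Icc 1 T).filter (fun t => η ∈ active b t),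
        (surrogate η (w t) (g t) (expertPredict σ U g b η t) - surrogate η (w t) (g t) u) ≤
        η * (α / 2 * sqNorm u) + E := hexp
    rw [lowZ, linRegret, variance]
    linarith
  have hdiv : ∀ X Y : ℝ, E ≤ X → X / η = Y → linRegret w g T u ≤
      η * variance w g T u + Y + lowZ T / η + α / 2 * sqNorm u + 2 * runMax b T := by
    intro X Y hX hY
    rw [← hY]
    refine le_of_mul_le_mul_left ?_ hη0
    have e : η * (η * variance w g T u + X / η + lowZ T / η + α / 2 * sqNorm u +
        2 * runMax b T) = η ^ 2 * variance w g T u + X + lowZ T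
      + η * (α / 2 * sqNorm u + 2 * runMax b T) := by field_simp; ring
    rw [e]
    linarith
  have hcoef : 2 * η ^ 2 * σ η ^ 2 = 2 * η / α := by rw [hσsq]; field_simp
  constructor
  · refine (hdiv _ _ hE1 rfl).trans (le_of_sub_nonneg ?_)
    have hlog : Real.log (1 + 2 * η ^ 2 * σ η ^ 2 * Q / (covariance g T).rank) ≤
        Real.log (1 + Q / (runMax b T * α * (covariance g T).rank)) := by
      have h0 : 0 ≤ 2 * η ^ 2 * σ η ^ 2 * Q / (covariance g T).rank := by positivity
      refine Real.log_le_log (by linarith) ?_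
      -- The condition η ≤ 1/(2B_T) removes η from the logarithm, so Z_T does not depend on the rate
      -- chosen later.
      have h1 : 2 * η / α ≤ 1 / (runMax b T * α) := by
        rw [div_le_div_iff₀ hα (by positivity)]
        rw [le_div_iff₀ (by positivity)] at hle
        nlinarith
      have h2 : Q / (runMax b T * α * (covariance g T).rank) =
          1 / (runMax b T * α) * Q / (covariance g T).rank := by
        rw [one_div_mul_eq_div, div_div]
      rw [hcoef, h2]
      gcongr
    have h3 : 0 ≤ ((covariance g T).rank * Real.log (1 + Q / (runMax b T * α *
        (covariance g T).rank)) - (covariance g T).rank *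
        Real.log (1 + 2 * η ^ 2 * σ η ^ 2 * Q / (covariance g T).rank)) / η := by
      refine div_nonneg (sub_nonneg.2 ?_) hη0.le
      gcongr
    rw [sub_div] at h3
    rw [add_div]
    linarith
  · have h := hdiv _ (2 / α * Q) hE2 (by rw [hcoef]; field_simp)
    linarith

end

theorem lowZ_pos (T : ℕ) : 0 < lowZ T := by
  have := log_ceilPos_nonneg (2 * Real.logb 2 T)
  unfold lowZ
  linarith

theorem variance_nonneg (w g : ℕ → Fin d → ℝ) (T : ℕ) (u : Fin d → ℝ) : 0 ≤ variance w g T u :=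
  Finset.sum_nonneg fun _ _ => sq_nonneg _

theorem fullZ_eq (α : ℝ) (g : ℕ → Fin d → ℝ) (b : ℕ → ℝ) (T : ℕ) :
    fullZ α g b T = (covariance g T).rank * Real.log (1 + (∑ t ∈ Finset.Icc 1 T, sqNorm (g t)) /
      (runMax b T * α * (covariance g T).rank)) + lowZ T := by
  rw [fullZ, lowZ, add_assoc]

theorem fullZ_pos {α : ℝ} (hα : 0 < α) (g : ℕ → Fin d → ℝ) (b : ℕ → ℝ) (T : ℕ) :
    0 < fullZ α g b T := by
  rw [fullZ_eq]
  have hB := runMax_nonneg b T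
  have hQ : 0 ≤ ∑ t ∈ Finset.Icc 1 T, sqNorm (g t) := Finset.sum_nonneg fun t _ => sq_nonneg _
  have h0 : 0 ≤ (∑ t ∈ Finset.Icc 1 T, sqNorm (g t)) /
      (runMax b T * α * (covariance g T).rank) := by positivity
  have := Real.log_nonneg (by linarith : 1 ≤ 1 + (∑ t ∈ Finset.Icc 1 T, sqNorm (g t)) /
      (runMax b T * α * (covariance g T).rank))
  exact add_pos_of_nonneg_of_pos (by positivity) (lowZ_pos T)

end Regret

end MetaGrad

end

theorem theorem11 {d : ℕ} (α : ℝ) (hα : 0 < α) (T : ℕ)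
    (U : ℕ → Set (Fin d → ℝ)) (f : ℕ → (Fin d → ℝ) → ℝ)
    (w g : ℕ → Fin d → ℝ) (b : ℕ → ℝ)
    (hw : ∀ t ∈ Finset.Icc 1 T,
      w t = MetaGrad.iterate (fun η => 1 / Real.sqrt (α * η)) U g b t)
    (hplay : MetaGrad.IsPlay T U f w g b)
    (hB : 0 < MetaGrad.runMax b T)
    (u : Fin d → ℝ) (hu : ∀ t ∈ Finset.Icc 1 T, u ∈ U t) :
    MetaGrad.linRegret w g T u ≤
        5 / 2 * Real.sqrt (MetaGrad.variance w g T u * MetaGrad.fullZ α g b T)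
          + 5 * MetaGrad.runMax b T * MetaGrad.fullZ α g b T
          + α / 2 * MetaGrad.sqNorm u + 2 * MetaGrad.runMax b T ∧
      MetaGrad.linRegret w g T u ≤
        5 / 2 * Real.sqrt (MetaGrad.variance w g T u * MetaGrad.lowZ T)
          + 5 * MetaGrad.runMax b T * MetaGrad.lowZ T
          + 2 / α * ∑ t ∈ Finset.Icc 1 T, MetaGrad.sqNorm (g t)
          + α / 2 * MetaGrad.sqNorm u + 2 * MetaGrad.runMax b T := by
  constructor
  · obtain ⟨η, hη, hle, h⟩ := MetaGrad.exists_grid_le (MetaGrad.variance_nonneg w g T u)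
      (MetaGrad.fullZ_pos hα g b T) hB
    have h1 := (MetaGrad.regret_le_of_grid hα hplay hw hB hu hη hle).1
    rw [← MetaGrad.fullZ_eq] at h1
    linarith
  · obtain ⟨η, hη, hle, h⟩ := MetaGrad.exists_grid_le (MetaGrad.variance_nonneg w g T u)
      (MetaGrad.lowZ_pos T) hB
    have h1 := (MetaGrad.regret_le_of_grid hα hplay hw hB hu hη hle).2
    linarith
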